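/- All graphs are finite and simple. For a graph $G$, let $\Delta(G)$ be its maximum degree and let $G^2$ be the graph on $V(G)$ in which two distinct vertices are adjacent if their distance in $G$ is at most $2$. Let $\operatorname{mad}(G)=\max_{H}\frac{2|E(H)|}{|V(H)|}$, the maximum being over all subgraphs $H$ of $G$ with at least one vertex. A graph is $k$-choosable if for every assignment $L$ of lists of colors to its vertices with $|L(v)|\ge k$ for all $v$ it has a proper coloring that gives each vertex $v$ a color from $L(v)$; $\chi_\ell$ denotes the least $k$ for which the graph is $k$-choosable. **Theorem.** Let $G$ be a graph and write $\Delta=\Delta(G)$. 1. For every integer $k\ge 6$: if $\Delta\le k$ and $\operatorname{mad}(G)<2+\frac{4k-8}{5k+2}$, then $\chi_\ell(G^2)\le k+1$. (The bound on $\operatorname{mad}(G)$ is $5/2$ for $k=6$ and $2+20/37$ for $k=7$.) 2. If $\Delta\ge 6$ and $\operatorname{mad}(G)<2+\frac{4\Delta-8}{5\Delta+2}$, then $\chi_\ell(G^2)=\Delta+1$. 3. In particular, if $\Delta\ge 6$ and $G$ is planar with girth at least $g$ for some integer $g\ge 7+\frac{12}{\Delta-2}$, then $\chi_\ell(G^2)=\Delta+1$.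 (The girth of a forest is infinite.) -/

import Mathlib

namespace SimpleGraph

/-- The square of `G`: same vertices, two distinct vertices being adjacent when their distance
in `G` is at most two (`edist` is infinite between different components). -/
def square {V : Type*} (G : SimpleGraph V) : SimpleGraph V where
  Adj u v := u ≠ v ∧ G.edist u v ≤ 2
  symm := ⟨fun u v h => ⟨h.1.symm, by rw [G.edist_comm]; exact h.2⟩⟩
  loopless := ⟨fun _ h => h.1 rfl⟩

/-- `G` is `k`-choosable: for every assignment of lists (finite sets of colors, the colors being
natural numbers) of size at least `k` there is a proper coloring from the lists. -/
def IsChoosable {V : Type*} (G : SimpleGraph V) (k : ℕ) : Prop :=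
  ∀ L : V → Finset ℕ, (∀ v, k ≤ (L v).card) → ∃ C : G.Coloring ℕ, ∀ v, C v ∈ L v

/-- The choice number (list chromatic number): the least `k` such that `G` is `k`-choosable,
and `⊤` if there is none. -/
noncomputable def choiceNumber {V : Type*} (G : SimpleGraph V) : ℕ∞ :=
  ⨅ k ∈ {n : ℕ | G.IsChoosable n}, (k : ℕ∞)

/-- The maximum average degree of a finite graph: the maximum of `2|E(H)|/|V(H)|` over all
subgraphs `H` with at least one vertex. -/
noncomputable def mad {V : Type*} (G : SimpleGraph V) : ℝ :=
  ⨆ H : {H : G.Subgraph // H.verts.Nonempty},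
    2 * (H.1.edgeSet.ncard : ℝ) / (H.1.verts.ncard : ℝ)

/-- `A` is a polygonal arc in the plane with endpoints `x` and `y`: the union of the `n ≥ 1`
segments of a polygonal path `p 0 = x, p 1, …, p n = y` with no self-intersection, that is,
consecutive segments meet in their common endpoint only and other segments are disjoint. -/
def IsPolygonalArc (x y : ℝ × ℝ) (A : Set (ℝ × ℝ)) : Prop :=
  ∃ (n : ℕ) (p : ℕ → ℝ × ℝ), 1 ≤ n ∧ p 0 = x ∧ p n = y ∧
    (∀ i < n, p i ≠ p (i + 1)) ∧
    (∀ i j : ℕ, i < j → j < n →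
      ∀ z ∈ segment ℝ (p i) (p (i + 1)) ∩ segment ℝ (p j) (p (j + 1)), j = i + 1 ∧ z = p j) ∧
    A = ⋃ i ∈ Set.Iio n, segment ℝ (p i) (p (i + 1))

/-- `pos` and `arc` form a drawing of `G` in the plane: vertices are distinct points, an edge is
a polygonal arc joining its two ends and containing no other vertex, and different edges meet
only in common ends. The values of `arc` on pairs that are not edges are irrelevant. -/
structure IsPlaneDrawing {V : Type*} (G : SimpleGraph V) (pos : V → ℝ × ℝ)
    (arc : Sym2 V → Set (ℝ × ℝ)) : Prop where
  pos_injective : Function.Injective pos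
  isPolygonalArc : ∀ u v : V, G.Adj u v → IsPolygonalArc (pos u) (pos v) (arc s(u, v))
  mem_of_pos_mem : ∀ e ∈ G.edgeSet, ∀ w : V, pos w ∈ arc e → w ∈ e
  inter_arc : ∀ e ∈ G.edgeSet, ∀ f ∈ G.edgeSet, e ≠ f →
    ∀ z ∈ arc e ∩ arc f, ∃ w : V, w ∈ e ∧ w ∈ f ∧ z = pos w

/-- A graph is planar if it can be drawn in the plane. -/
def IsPlanar {V : Type*} (G : SimpleGraph V) : Prop :=
  ∃ (pos : V → ℝ × ℝ) (arc : Sym2 V → Set (ℝ × ℝ)), G.IsPlaneDrawing pos arc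

end SimpleGraph

/-!
# Choosability of squares of sparse graphs

The upper bound on the choice number is a reducibility and discharging argument. Fix lists of size
`k + 1` and a graph that is minimal, under deletion of edges, among the spanning subgraphs whose
square cannot be colored from the lists. Let `K` be the core of the square: the largest set of
vertices each having at least `k + 1` neighbors in it (`exists_core`). A coloring of `K` always
extends, so every configuration that can be recolored inside `K` after deleting an edge is
excluded. This gives two kinds of information.

* Locally (`IsReduced`), the vertices off the core are independent, and every core vertex sees at
  least `k + 1` core vertices within distance two.
* Globally (`IsReduced.card_slot_le`), paths of three vertices of degree two join vertices of
  degree `k` and form a forest, up to one cycle per component: the multigraph with these paths as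
  edges has at most as many edges as vertices. Otherwise Hall's theorem yields directed cycles in
  it, and the ends of the paths on these cycles form even cycles in the square, whose vertices
  retain two colors each. That such cycles are colorable follows from the existence of kernels in
  bipartite digraphs (`exists_listColoring_of_bipartite_orientation`).

Discharging (`flow`) then moves charge from the vertices of high degree to those of degree two and
shows that the average degree of the graph, isolated vertices excluded, is at least
`2 + (4 * k - 8) / (5 * k + 2)` (`IsReduced.le_sum_degree`). The lower bound on the choice number
holds because a closed neighborhood is a clique of the square.

For planar graphs it remains to bound `mad` by the girth `g`. A polygonal drawing is a system of
segments (`SegmentSystem`). For an even set `Z` of segments, the parity of the number of members of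
`Z` above a point is locally constant off `Z` and changes across each member of `Z`. The points on
which all these parities agree form regions, and the boundaries of the regions are even sets of
edges that span all even sets and contain each edge at most twice. As the even sets form a space of
dimension at least `|E| - |V| + 1` and each nonempty one contains a cycle, there are at least
`|E| - |V| + 1` boundaries with at least `g` edges, and double counting gives
`g * (|E| - |V| + 1) ≤ 2 * |E|` (`mul_card_edgeSet_le_of_span`). Neither Euler's formula nor the
Jordan curve theorem is needed.
-/

namespace SimpleGraph

/-! ### List colorings from bipartite orientations -/

/-- A digraph whose underlying graph is bipartite has a kernel in every finite vertex set:
an independent set `T` that every other vertex points into. -/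
theorem exists_kernel {α : Type*} [DecidableEq α] (R : α → α → Prop) (X : α → Prop)
    (hX : ∀ a b, R a b → (X a ↔ ¬ X b)) (S : Finset α) :
    ∃ T ⊆ S, (∀ a ∈ T, ∀ b ∈ T, ¬ R a b) ∧ ∀ a ∈ S, a ∉ T → ∃ b ∈ T, R a b := by
  classical
  induction S using Finset.strongInduction with
  | H S ih =>
    by_cases h : ∃ s ∈ S, ∀ b ∈ S, ¬ R s b
    · -- A sink joins the kernel, and the vertices pointing to it are discarded.
      obtain ⟨s, hs, hsink⟩ := h
      obtain ⟨T, hTS, hT, hker⟩ := ih (S.filter fun a => a ≠ s ∧ ¬ R a s)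
        ((Finset.filter_ssubset).2 ⟨s, hs, by simp⟩)
      have hTS' : T ⊆ S := hTS.trans (Finset.filter_subset _ _)
      refine ⟨insert s T, Finset.insert_subset hs hTS', ?_, ?_⟩
      · intro a ha b hb
        rcases Finset.mem_insert.1 ha with rfl | ha'
        · exact hsink b (Finset.insert_subset hs hTS' hb)
        · rcases Finset.mem_insert.1 hb with rfl | hb'
          · exact (Finset.mem_filter.1 (hTS ha')).2.2
          · exact hT a ha' b hb'
      · intro a ha haT
        simp only [Finset.mem_insert, not_or] at haT
        by_cases has : R a s
        · exact ⟨s, Finset.mem_insert_self _ _, has⟩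
        · obtain ⟨b, hb, hab⟩ := hker a (Finset.mem_filter.2 ⟨ha, haT.1, has⟩) haT.2
          exact ⟨b, Finset.mem_insert_of_mem hb, hab⟩
    · -- Without sinks, one side of the bipartition is a kernel.
      push Not at h
      refine ⟨S.filter X, Finset.filter_subset _ _, ?_, ?_⟩
      · intro a ha b hb hab
        exact (hX a b hab).1 (Finset.mem_filter.1 ha).2 (Finset.mem_filter.1 hb).2
      · intro a ha haT
        obtain ⟨b, hb, hab⟩ := h a ha
        refine ⟨b, Finset.mem_filter.2 ⟨hb, ?_⟩, hab⟩
        have : ¬ X a := fun hXa => haT (Finset.mem_filter.2 ⟨ha, hXa⟩)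
        by_contra hb'
        exact this ((hX a b hab).2 hb')

/-- If a bipartite graph is oriented so that every list is longer than the outdegree, then it can
be colored from the lists: one color at a time is given to a kernel of the vertices allowing it. -/
theorem exists_listColoring_of_bipartite_orientation {α : Type*} [DecidableEq α]
    (R : α → α → Prop) [DecidableRel R] (X : α → Prop)
    (hX : ∀ a b, R a b → (X a ↔ ¬ X b)) (S : Finset α) (L : α → Finset ℕ)
    (hL : ∀ a ∈ S, (S.filter (R a)).card < (L a).card) :
    ∃ C : α → ℕ, (∀ a ∈ S, C a ∈ L a) ∧ ∀ a ∈ S, ∀ b ∈ S, R a b → C a ≠ C b := by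
  induction S using Finset.strongInduction generalizing L with
  | H S ih =>
    rcases S.eq_empty_or_nonempty with rfl | ⟨s, hs⟩
    · exact ⟨fun _ => 0, by simp, by simp⟩
    obtain ⟨c, hc⟩ : (L s).Nonempty := Finset.card_pos.1 (Nat.zero_lt_of_lt (hL s hs))
    obtain ⟨T, hTS, hT, hker⟩ := exists_kernel R X hX (S.filter fun a => c ∈ L a)
    have hTS' : T ⊆ S := hTS.trans (Finset.filter_subset _ _)
    have hTne : T.Nonempty := by
      by_cases hsT : s ∈ T
      · exact ⟨s, hsT⟩
      · obtain ⟨b, hb, -⟩ := hker s (Finset.mem_filter.2 ⟨hs, hc⟩) hsT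
        exact ⟨b, hb⟩
    obtain ⟨C, hCL, hC⟩ := ih (S \ T) (Finset.sdiff_ssubset hTS' hTne)
      (fun a => (L a).erase c) (by
        intro a ha
        rw [Finset.mem_sdiff] at ha
        have hsub : (S \ T).filter (R a) ⊆ S.filter (R a) :=
          Finset.filter_subset_filter _ Finset.sdiff_subset
        have h1 := hL a ha.1
        by_cases hca : c ∈ L a
        · obtain ⟨b, hb, hab⟩ := hker a (Finset.mem_filter.2 ⟨ha.1, hca⟩) ha.2
          have : (S \ T).filter (R a) ⊂ S.filter (R a) := by
            refine (Finset.ssubset_iff_of_subset hsub).2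
              ⟨b, Finset.mem_filter.2 ⟨hTS' hb, hab⟩, fun h => ?_⟩
            exact (Finset.mem_sdiff.1 (Finset.mem_filter.1 h).1).2 hb
          have h2 := Finset.card_lt_card this
          rw [Finset.card_erase_of_mem hca]
          omega
        · rw [Finset.erase_eq_of_notMem hca]
          exact (Finset.card_le_card hsub).trans_lt h1)
    refine ⟨fun a => if a ∈ T then c else C a, ?_, ?_⟩
    · intro a ha
      by_cases haT : a ∈ T
      · simpa [haT] using (Finset.mem_filter.1 (hTS haT)).2
      · simpa [haT] using Finset.mem_of_mem_erase (hCL a (Finset.mem_sdiff.2 ⟨ha, haT⟩))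
    · intro a ha b hb hab
      by_cases haT : a ∈ T <;> by_cases hbT : b ∈ T <;> simp only [haT, hbT, if_true, if_false]
      · exact absurd hab (hT a haT b hbT)
      · exact (Finset.ne_of_mem_erase (hCL b (Finset.mem_sdiff.2 ⟨hb, hbT⟩))).symm
      · exact Finset.ne_of_mem_erase (hCL a (Finset.mem_sdiff.2 ⟨ha, haT⟩))
      · exact hC a (Finset.mem_sdiff.2 ⟨ha, haT⟩) b (Finset.mem_sdiff.2 ⟨hb, hbT⟩) hab

/-! ### Partial list colorings and cores -/

/-- `C` is a proper coloring from the lists `L` of the part of `Q` induced on `S`. -/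
def IsListColoringOn {V : Type*} (Q : SimpleGraph V) (L : V → Finset ℕ) (S : Finset V)
    (C : V → ℕ) : Prop :=
  (∀ v ∈ S, C v ∈ L v) ∧ ∀ u ∈ S, ∀ v ∈ S, Q.Adj u v → C u ≠ C v

section Core

variable {V : Type*} [Fintype V] [DecidableEq V] (Q : SimpleGraph V) [DecidableRel Q.Adj]

lemma IsListColoringOn.insert {Q : SimpleGraph V} [DecidableRel Q.Adj]
    {L : V → Finset ℕ} {S : Finset V} {C : V → ℕ}
    (hC : Q.IsListColoringOn L S C) {v : V} (hv : v ∉ S)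
    (hcard : (Q.neighborFinset v ∩ S).card < (L v).card) :
    ∃ c, Q.IsListColoringOn L (insert v S) (Function.update C v c) := by
  obtain ⟨c, hc, hcn⟩ : ∃ c ∈ L v, c ∉ (Q.neighborFinset v ∩ S).image C :=
    Finset.exists_mem_notMem_of_card_lt_card (Finset.card_image_le.trans_lt hcard)
  have hne : ∀ u ∈ S, u ≠ v := fun u hu h => hv (h ▸ hu)
  have hcol : ∀ u ∈ S, Q.Adj v u → c ≠ C u := by
    intro u hu hvu h
    exact hcn (Finset.mem_image.2 ⟨u, by simp [hvu, hu], h.symm⟩)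
  refine ⟨c, ?_, ?_⟩
  · intro u hu
    rcases Finset.mem_insert.1 hu with rfl | hu
    · simpa using hc
    · simpa [hne u hu] using hC.1 u hu
  · intro u hu w hw huw
    rcases Finset.mem_insert.1 hu with rfl | hu' <;> rcases Finset.mem_insert.1 hw with rfl | hw'
    · exact absurd huw (Q.loopless.irrefl _)
    · simpa [hne w hw'] using hcol w hw' huw
    · simpa [hne u hu'] using (hcol u hu' huw.symm).symm
    · simpa [hne u hu', hne w hw'] using hC.2 u hu' w hw' huw

/-- A finite graph has a largest set `K` in which every vertex has at least `k + 1` neighbors, and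
a coloring of `K` from lists of size `k + 1` extends to the whole graph, because
the vertices outside can be ordered so that each has at most `k` earlier neighbors. -/
theorem exists_core (k : ℕ) (L : V → Finset ℕ) (hL : ∀ v, k + 1 ≤ (L v).card) :
    ∃ K : Finset V, (∀ v ∈ K, k + 1 ≤ (Q.neighborFinset v ∩ K).card) ∧
      ∀ C, Q.IsListColoringOn L K C → ∃ C', Q.IsListColoringOn L Finset.univ C' := by
  obtain ⟨K, hK⟩ : ∃ K : Finset V, Maximal
      (fun K : Finset V => ∀ v ∈ K, k + 1 ≤ (Q.neighborFinset v ∩ K).card) K :=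
    Set.Finite.exists_maximal (Set.toFinite _) ⟨∅, fun v hv => absurd hv (Finset.notMem_empty v)⟩
  refine ⟨K, hK.prop, ?_⟩
  have hdeg : ∀ T : Finset V, K ⊂ T → ∃ v ∈ T, v ∉ K ∧ (Q.neighborFinset v ∩ T).card ≤ k := by
    intro T hT
    by_contra! hcon
    refine hT.not_subset (hK.le_of_ge (y := T) (fun v hv => ?_) hT.subset)
    by_cases hvK : v ∈ K
    · exact (hK.prop v hvK).trans
        (Finset.card_le_card (Finset.inter_subset_inter_left hT.subset))
    · exact hcon v hv hvK
  intro C hC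
  have key : ∀ T : Finset V, K ⊆ T → ∃ C', Q.IsListColoringOn L T C' := by
    intro T
    induction T using Finset.strongInduction with
    | H T ih =>
      intro hKT
      rcases hKT.eq_or_ssubset with rfl | hss
      · exact ⟨C, hC⟩
      obtain ⟨v, hvT, hvK, hvk⟩ := hdeg T hss
      obtain ⟨C', hC'⟩ := ih (T.erase v) (Finset.erase_ssubset hvT)
        (Finset.subset_erase.2 ⟨hKT, hvK⟩)
      obtain ⟨c, hc⟩ := hC'.insert (Finset.notMem_erase v T)
        ((Finset.card_le_card (Finset.inter_subset_inter_left
          (Finset.erase_subset _ _))).trans_lt (Nat.lt_of_le_of_lt hvk (hL v)))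
      rw [Finset.insert_erase hvT] at hc
      exact ⟨_, hc⟩
  exact key Finset.univ (Finset.subset_univ K)

end Core

/-! ### Directed cycles of slots in a multigraph -/

/-- A finite multigraph with at least as many edges as vertices has a nonempty set of edges that
can be oriented with all in- and outdegrees equal and at most one. The edges are given by their
half-edges `a ∈ A`: `hub a` is the vertex at `a`, `mid a` the edge, and `mate a` the other half.
The set `X` consists of the half-edges at the tails of the oriented edges. -/
theorem exists_directed_cycles {α β γ : Type*} [DecidableEq α] [DecidableEq β] [DecidableEq γ]
    (A : Finset α) (B : Finset β) (hub : α → β) (mid : α → γ) (mate : α → α)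
    (hhub : ∀ a ∈ A, hub a ∈ B) (hmate : ∀ a ∈ A, mate a ∈ A)
    (hne : ∀ a ∈ A, mate a ≠ a) (hinv : ∀ a ∈ A, mate (mate a) = a)
    (hmm : ∀ a ∈ A, mid (mate a) = mid a)
    (hmid : ∀ a ∈ A, ∀ a' ∈ A, mid a' = mid a → a' = a ∨ a' = mate a)
    (hA : A.Nonempty) (hcard : 2 * B.card ≤ A.card) :
    ∃ X ⊆ A, X.Nonempty ∧ (∀ a ∈ X, mate a ∉ X) ∧ Set.InjOn hub X ∧
      Set.InjOn (hub ∘ mate) X ∧ X.image hub = X.image (hub ∘ mate) := by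
  classical
  -- A minimal set `S` of vertices spanning at least `|S|` edges has all degrees at least two.
  set AS : Finset β → Finset α := fun S => A.filter fun a => hub a ∈ S ∧ hub (mate a) ∈ S
    with hAS
  have hmemAS : ∀ S a, a ∈ AS S ↔ a ∈ A ∧ hub a ∈ S ∧ hub (mate a) ∈ S := by
    intro S a; simp [hAS]
  obtain ⟨S, hS⟩ : ∃ S : Finset β, Minimal
      (fun S : Finset β => S ⊆ B ∧ S.Nonempty ∧ 2 * S.card ≤ (AS S).card) S := by
    have hfin : {S : Finset β | S ⊆ B ∧ S.Nonempty ∧ 2 * S.card ≤ (AS S).card}.Finite :=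
      (Finset.finite_toSet B.powerset).subset fun S hS => by simpa using hS.1
    refine hfin.exists_minimal ⟨B, le_rfl, ?_, ?_⟩
    · obtain ⟨a, ha⟩ := hA
      exact ⟨_, hhub a ha⟩
    · refine hcard.trans (Finset.card_le_card fun a ha => (hmemAS _ _).2
        ⟨ha, hhub a ha, hhub _ (hmate a ha)⟩)
  obtain ⟨hSB, hSne, hScard⟩ := hS.prop
  have htwo : ∀ u ∈ S, 2 ≤ ((AS S).filter fun a => hub a = u).card := by
    intro u hu
    by_contra! hlt
    have hsub : AS S ⊆ AS (S.erase u) ∪ (((AS S).filter fun a => hub a = u) ∪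
        ((AS S).filter fun a => hub a = u).image mate) := by
      intro a ha
      obtain ⟨haA, h1, h2⟩ := (hmemAS _ _).1 ha
      by_cases hau : hub a = u
      · simp [ha, hau]
      by_cases hmu : hub (mate a) = u
      · refine Finset.mem_union_right _ (Finset.mem_union_right _ (Finset.mem_image.2
          ⟨mate a, Finset.mem_filter.2 ⟨(hmemAS _ _).2 ⟨hmate a haA, h2, ?_⟩, hmu⟩, hinv a haA⟩))
        rwa [hinv a haA]
      · exact Finset.mem_union_left _ ((hmemAS _ _).2
          ⟨haA, Finset.mem_erase.2 ⟨hau, h1⟩, Finset.mem_erase.2 ⟨hmu, h2⟩⟩)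
    have h1 := (Finset.card_le_card hsub).trans (Finset.card_union_le _ _)
    have h2 := Finset.card_union_le ((AS S).filter fun a => hub a = u)
      (((AS S).filter fun a => hub a = u).image mate)
    have h3 : (((AS S).filter fun a => hub a = u).image mate).card ≤ _ := Finset.card_image_le
    have h4 := Finset.card_erase_of_mem hu
    have hpos : 0 < S.card := Finset.card_pos.2 hSne
    rcases (S.erase u).eq_empty_or_nonempty with he | hne'
    · have h0 : AS (S.erase u) = ∅ := by
        rw [he]; ext a; simp [hmemAS]
      have hS1 : ∀ w ∈ S, w = u := by
        intro w hw
        by_contra hwu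
        simpa [he] using Finset.mem_erase.2 ⟨hwu, hw⟩
      have : AS S = (AS S).filter fun a => hub a = u := by
        refine (Finset.filter_true_of_mem fun a ha => hS1 _ ((hmemAS _ _).1 ha).2.1).symm
      rw [← this] at hlt
      omega
    · refine absurd (hS.le_of_le (y := S.erase u)
        ⟨(Finset.erase_subset _ _).trans hSB, hne', by omega⟩ (Finset.erase_subset _ _))
        (fun h => Finset.notMem_erase u S (h hu))
  -- Hall's theorem assigns to the vertices of `S` distinct incident edges.
  obtain ⟨m, hminj, hm⟩ := (Finset.all_card_le_biUnion_card_iff_exists_injective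
    (fun u : S => ((AS S).filter fun a => hub a = u).image mid)).1 (by
      intro S'
      set sl := S'.biUnion fun u : S => (AS S).filter fun a => hub a = u with hsl
      have h1 : sl.card = ∑ u ∈ S', ((AS S).filter fun a => hub a = (u : β)).card := by
        refine Finset.card_biUnion fun u _ w _ huw => Finset.disjoint_left.2 fun a ha hb => ?_
        exact huw (Subtype.ext
          ((Finset.mem_filter.1 ha).2.symm.trans (Finset.mem_filter.1 hb).2))
      have h2 : 2 * S'.card ≤ sl.card := by
        rw [h1, mul_comm]
        exact Finset.card_nsmul_le_sum S' _ 2 (fun (u : S) _ => htwo u.1 u.2)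
      have h3 : sl.card ≤ 2 * (sl.image mid).card := by
        refine Finset.card_le_mul_card_image _ _ fun b hb => ?_
        obtain ⟨a, ha, rfl⟩ := Finset.mem_image.1 hb
        have hslA : ∀ a ∈ sl, a ∈ A := by
          intro a ha
          obtain ⟨u, -, hu⟩ := Finset.mem_biUnion.1 ha
          exact ((hmemAS _ _).1 (Finset.mem_filter.1 hu).1).1
        have : (sl.filter fun x => mid x = mid a) ⊆ {a, mate a} := by
          intro x hx
          rw [Finset.mem_filter] at hx
          simpa using hmid a (hslA a ha) x (hslA x hx.1) hx.2
        exact (Finset.card_le_card this).trans Finset.card_le_two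
      have h4 : sl.image mid = S'.biUnion fun u : S =>
          ((AS S).filter fun a => hub a = u).image mid := by
        rw [hsl, Finset.biUnion_image]
      rw [← h4]
      omega)
  have hm' : ∀ u : S, ∃ a ∈ AS S, hub a = u ∧ mid a = m u := by
    intro u
    obtain ⟨a, ha, hau⟩ := Finset.mem_image.1 (hm u)
    exact ⟨a, (Finset.mem_filter.1 ha).1, (Finset.mem_filter.1 ha).2, hau⟩
  choose x hxA hxhub hxmid using hm'
  have hx' : ∀ u, x u ∈ A ∧ hub (mate (x u)) ∈ S := fun u =>
    ⟨((hmemAS _ _).1 (hxA u)).1, ((hmemAS _ _).1 (hxA u)).2.2⟩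
  -- Following the assigned edges, a minimal invariant set of vertices is permuted.
  set ψ : S → S := fun u => ⟨hub (mate (x u)), (hx' u).2⟩ with hψ
  obtain ⟨P, hP⟩ : ∃ P : Finset S, Minimal
      (fun P : Finset S => P.Nonempty ∧ ∀ u ∈ P, ψ u ∈ P) P := by
    refine Set.Finite.exists_minimal (Set.toFinite _) ⟨Finset.univ, ?_, by simp⟩
    obtain ⟨u, hu⟩ := hSne
    exact ⟨⟨u, hu⟩, Finset.mem_univ _⟩
  have himg : P.image ψ = P := by
    have hsub : P.image ψ ⊆ P := Finset.image_subset_iff.2 hP.prop.2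
    refine le_antisymm hsub (hP.le_of_le (y := P.image ψ) ⟨hP.prop.1.image _, ?_⟩ hsub)
    intro u hu
    exact Finset.mem_image_of_mem _ (hsub hu)
  have hψinj : Set.InjOn ψ P := Finset.injOn_of_card_image_eq (by rw [himg])
  refine ⟨P.image x, ?_, hP.prop.1.image _, ?_, ?_, ?_, ?_⟩
  · intro a ha
    obtain ⟨u, -, rfl⟩ := Finset.mem_image.1 ha
    exact (hx' u).1
  · intro a ha hma
    obtain ⟨u, -, rfl⟩ := Finset.mem_image.1 ha
    obtain ⟨w, -, hw⟩ := Finset.mem_image.1 hma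
    have : m w = m u := by rw [← hxmid, ← hxmid, hw, hmm _ (hx' u).1]
    rw [hminj this] at hw
    exact hne _ (hx' u).1 hw.symm
  · rintro a ha b hb hab
    obtain ⟨u, -, rfl⟩ := Finset.mem_image.1 (Finset.mem_coe.1 ha)
    obtain ⟨w, -, rfl⟩ := Finset.mem_image.1 (Finset.mem_coe.1 hb)
    rw [hxhub, hxhub] at hab
    rw [Subtype.ext hab]
  · rintro a ha b hb hab
    obtain ⟨u, hu, rfl⟩ := Finset.mem_image.1 (Finset.mem_coe.1 ha)
    obtain ⟨w, hw, rfl⟩ := Finset.mem_image.1 (Finset.mem_coe.1 hb)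
    rw [hψinj hu hw (Subtype.ext hab)]
  · have h1 : (P.image x).image hub = P.image Subtype.val := by
      rw [Finset.image_image]
      exact Finset.image_congr fun u _ => hxhub u
    have h2 : (P.image x).image (hub ∘ mate) = (P.image ψ).image Subtype.val := by
      rw [Finset.image_image, Finset.image_image]
      rfl
    rw [h1, h2, himg]

/-! ### The square of a graph -/

lemma square_adj_iff {V : Type*} {G : SimpleGraph V} {u v : V} :
    G.square.Adj u v ↔ u ≠ v ∧ (G.Adj u v ∨ ∃ w, G.Adj u w ∧ G.Adj w v) := by
  constructor
  · rintro ⟨hne, h⟩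
    refine ⟨hne, ?_⟩
    obtain ⟨p, hp⟩ := exists_walk_of_edist_ne_top
      (ne_top_of_le_ne_top (by decide : (2 : ℕ∞) ≠ ⊤) h)
    rw [← hp] at h
    have h2 : p.length ≤ 2 := by exact_mod_cast h
    match p, h2 with
    | .nil, _ => exact absurd rfl hne
    | .cons h .nil, _ => exact Or.inl h
    | .cons h (.cons h' .nil), _ => exact Or.inr ⟨_, h, h'⟩
  · rintro ⟨hne, h | ⟨w, h, h'⟩⟩
    · exact ⟨hne, (edist_le (Walk.cons h .nil)).trans (by simp)⟩
    · exact ⟨hne, (edist_le (Walk.cons h (.cons h' .nil))).trans (by simp)⟩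

lemma square_adj_deleteEdges {V : Type*} {G : SimpleGraph V} {x y u v : V}
    (h : G.square.Adj u v) (hux : u ≠ x) (huy : u ≠ y) (hvx : v ≠ x) (hvy : v ≠ y) :
    (G.deleteEdges {s(x, y)}).square.Adj u v := by
  rw [square_adj_iff] at h ⊢
  refine ⟨h.1, ?_⟩
  rcases h.2 with h | ⟨w, h, h'⟩
  · left
    simp [deleteEdges_adj, h, hux, huy]
  · right
    exact ⟨w, by simp [deleteEdges_adj, h, hux, huy], by simp [deleteEdges_adj, h', hvx, hvy]⟩

/-! ### The structure of critical graphs -/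

/-- A coloring of `K \ W` extends to `K` when `W` has a bipartite orientation in which the
outdegree of each vertex is less than the number of colors not used on its neighbors. -/
theorem IsListColoringOn.extend_of_bipartite_orientation {V : Type*} [Fintype V] [DecidableEq V]
    {Q : SimpleGraph V} [DecidableRel Q.Adj] {L : V → Finset ℕ} {K W : Finset V} {C : V → ℕ}
    (hC : Q.IsListColoringOn L (K \ W) C)
    (R : V → V → Prop) [DecidableRel R] (X : V → Prop) (hX : ∀ a b, R a b → (X a ↔ ¬ X b))
    (hR : ∀ a ∈ W, ∀ b ∈ W, Q.Adj a b → R a b ∨ R b a)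
    (hL : ∀ a ∈ W, (W.filter (R a)).card + (Q.neighborFinset a ∩ (K \ W)).card < (L a).card) :
    ∃ C', Q.IsListColoringOn L K C' := by
  obtain ⟨D, hDL, hD⟩ := exists_listColoring_of_bipartite_orientation R X hX W
    (fun a => L a \ (Q.neighborFinset a ∩ (K \ W)).image C) (by
      intro a ha
      have h1 := Finset.le_card_sdiff ((Q.neighborFinset a ∩ (K \ W)).image C) (L a)
      have h2 : ((Q.neighborFinset a ∩ (K \ W)).image C).card ≤ _ := Finset.card_image_le
      have h3 := hL a ha
      omega)
  have hDC : ∀ a ∈ W, ∀ b ∈ K, b ∉ W → Q.Adj a b → D a ≠ C b := by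
    intro a ha b hb hbW hab h
    refine (Finset.mem_sdiff.1 (hDL a ha)).2 (Finset.mem_image.2 ⟨b, ?_, h.symm⟩)
    simp [hab, hb, hbW]
  refine ⟨fun v => if v ∈ W then D v else C v, ?_, ?_⟩
  · intro v hv
    by_cases hvW : v ∈ W
    · simpa [hvW] using (Finset.mem_sdiff.1 (hDL v hvW)).1
    · simpa [hvW] using hC.1 v (Finset.mem_sdiff.2 ⟨hv, hvW⟩)
  · intro u hu v hv huv
    by_cases huW : u ∈ W <;> by_cases hvW : v ∈ W <;> simp only [huW, hvW, if_true, if_false]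
    · rcases hR u huW v hvW huv with h | h
      · exact hD u huW v hvW h
      · exact (hD v hvW u huW h).symm
    · exact hDC u huW v hv hvW huv
    · exact (hDC v hvW u hu huW huv.symm).symm
    · exact hC.2 u (Finset.mem_sdiff.2 ⟨hu, huW⟩) v (Finset.mem_sdiff.2 ⟨hv, hvW⟩) huv

section Critical

variable {V : Type*} [Fintype V] [DecidableEq V] (G : SimpleGraph V) [DecidableRel G.Adj]

/-- The number of neighbors of `v` in `K`. -/
def coreDegree (K : Finset V) (v : V) : ℕ := (G.neighborFinset v ∩ K).card

/-- An upper bound for the number of vertices of `K` that a vertex of `K` sees in the square of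
`G` through its neighbor `y`, including `y` itself. -/
def coreReach (K : Finset V) (y : V) : ℕ :=
  if y ∈ K then G.coreDegree K y else G.coreDegree K y - 1

/-- `b` is the middle of three consecutive vertices of degree two. -/
def IsMid (b : V) : Prop := G.degree b = 2 ∧ ∀ y, G.Adj b y → G.degree y = 2

/-- `a` is an end of three consecutive vertices of degree two. -/
def IsSlot (a : V) : Prop := ∃ b, G.Adj a b ∧ G.IsMid b

/-- The structure of a graph that is critical for coloring its square from lists of size `k + 1`,
relative to the core `K` of the square. -/
structure IsReduced (k : ℕ) (K : Finset V) : Prop where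
  degree_le : ∀ v, G.degree v ≤ k
  le_sum_coreReach : ∀ v ∈ K, k + 1 ≤ ∑ y ∈ G.neighborFinset v, G.coreReach K y
  of_notMem : ∀ x ∉ K, ∀ y, G.Adj x y → y ∈ K ∧ ∃ z ∈ K, z ≠ y ∧ G.Adj x z

variable {G}

lemma coreDegree_le_degree (K : Finset V) (v : V) : G.coreDegree K v ≤ G.degree v :=
  Finset.card_le_card Finset.inter_subset_left

lemma coreReach_le_degree (K : Finset V) (v : V) : G.coreReach K v ≤ G.degree v := by
  have := G.coreDegree_le_degree K v
  unfold coreReach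
  split_ifs <;> omega

lemma exists_neighborFinset_eq_pair {a : V} (ha : G.degree a = 2) {b : V}
    (hb : G.Adj a b) : ∃ u, u ≠ b ∧ G.neighborFinset a = {u, b} := by
  obtain ⟨x, y, hxy, h⟩ := Finset.card_eq_two.1 ha
  have : b ∈ G.neighborFinset a := by simpa using hb
  rw [h, Finset.mem_insert, Finset.mem_singleton] at this
  rcases this with rfl | rfl
  · exact ⟨y, hxy.symm, by rw [h, Finset.pair_comm]⟩
  · exact ⟨x, hxy, h⟩

lemma card_square_inter_le [DecidableRel G.square.Adj] {K : Finset V} {v : V} (hv : v ∈ K) :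
    (G.square.neighborFinset v ∩ K).card ≤ ∑ y ∈ G.neighborFinset v, G.coreReach K y := by
  have hsub : G.square.neighborFinset v ∩ K ⊆ (G.neighborFinset v).biUnion fun y =>
      (if y ∈ K then {y} else ∅) ∪ (G.neighborFinset y ∩ K).erase v := by
    intro w hw
    rw [Finset.mem_inter, mem_neighborFinset, square_adj_iff] at hw
    obtain ⟨⟨hne, h | ⟨y, h, h'⟩⟩, hwK⟩ := hw
    · exact Finset.mem_biUnion.2 ⟨w, by simpa using h, by simp [hwK]⟩
    · refine Finset.mem_biUnion.2 ⟨y, by simpa using h, Finset.mem_union_right _ ?_⟩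
      simp [hne.symm, h', hwK]
  refine (Finset.card_le_card hsub).trans (Finset.card_biUnion_le.trans
    (Finset.sum_le_sum fun y hy => (Finset.card_union_le _ _).trans ?_))
  have hvy : v ∈ G.neighborFinset y ∩ K := by
    rw [mem_neighborFinset] at hy
    simpa [hv] using hy.symm
  have hpos := Finset.card_pos.2 ⟨v, hvy⟩
  rw [Finset.card_erase_of_mem hvy, coreReach, coreDegree]
  split_ifs with h
  · simp only [Finset.card_singleton]; omega
  · simp

lemma IsReduced.mid_notMem {k : ℕ} {K : Finset V} (h : G.IsReduced k K) (hk : 6 ≤ k) {b : V}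
    (hb : G.IsMid b) : b ∉ K := by
  intro hbK
  have h1 := h.le_sum_coreReach b hbK
  have h2 : ∑ y ∈ G.neighborFinset b, G.coreReach K y ≤ (G.neighborFinset b).card • 2 :=
    Finset.sum_le_card_nsmul _ _ _ fun y hy =>
      (coreReach_le_degree K y).trans (hb.2 y (by simpa using hy)).le
  rw [card_neighborFinset_eq_degree, hb.1, smul_eq_mul] at h2
  omega

/-- A slot has degree two and lies in the core, and its neighbor off the middle vertex has
degree `k`. -/
lemma IsReduced.slot {k : ℕ} {K : Finset V} (h : G.IsReduced k K) (hk : 6 ≤ k) {a b : V}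
    (hab : G.Adj a b) (hb : G.IsMid b) : a ∈ K ∧ G.degree a = 2 ∧
      ∃ u, u ≠ b ∧ G.neighborFinset a = {u, b} ∧ G.degree u = k := by
  have hbK := h.mid_notMem hk hb
  have haK := (h.of_notMem b hbK a hab.symm).1
  have ha2 := hb.2 a hab.symm
  obtain ⟨u, hub, hu⟩ := exists_neighborFinset_eq_pair ha2 hab
  refine ⟨haK, ha2, u, hub, hu, ?_⟩
  have h1 := h.le_sum_coreReach a haK
  rw [hu, Finset.sum_pair hub] at h1
  have h2 : G.coreReach K b ≤ 1 := by
    have := G.coreDegree_le_degree K b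
    rw [coreReach, if_neg hbK]
    have := hb.1
    omega
  have h3 := G.coreReach_le_degree K u
  have h4 := h.degree_le u
  omega

end Critical

section Critical

variable {V : Type*} [Fintype V] [DecidableEq V] {G : SimpleGraph V} [DecidableRel G.Adj]

/-- In a critical graph there are at most two slots per vertex of degree `k`: otherwise the
threads with three interior vertices contain directed cycles, and the slots on these cycles can be
recolored, as each has two colors left and they form even cycles in the square. -/
lemma IsReduced.card_slot_le {k : ℕ} {K : Finset V} (h : G.IsReduced k K) (hk : 6 ≤ k)
    [DecidableRel G.square.Adj] [DecidablePred G.IsSlot] {L : V → Finset ℕ}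
    (hL : ∀ v, k + 1 ≤ (L v).card)
    (hcrit : ∀ x y, G.Adj x y →
      ∃ C, (G.deleteEdges {s(x, y)}).square.IsListColoringOn L Finset.univ C)
    (hK : ∀ C, ¬ G.square.IsListColoringOn L K C) :
    (Finset.univ.filter G.IsSlot).card ≤ 2 * (Finset.univ.filter fun v => G.degree v = k).card := by
  set A := Finset.univ.filter G.IsSlot with hAdef
  by_contra! hcard
  have hdata : ∀ a, ∃ b u c, G.IsSlot a → G.Adj a b ∧ G.IsMid b ∧ u ≠ b ∧
      G.neighborFinset a = {u, b} ∧ G.degree u = k ∧ c ≠ a ∧ G.neighborFinset b = {c, a} := by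
    intro a
    by_cases ha : G.IsSlot a
    · obtain ⟨b, hab, hb⟩ := ha
      obtain ⟨haK, ha2, u, hub, hu, huk⟩ := h.slot hk hab hb
      obtain ⟨c, hca, hc⟩ := exists_neighborFinset_eq_pair hb.1 hab.symm
      exact ⟨b, u, c, fun _ => ⟨hab, hb, hub, hu, huk, hca, hc⟩⟩
    · exact ⟨a, a, a, fun h => absurd h ha⟩
  choose mid hub mate hdata using hdata
  have hA : ∀ a, a ∈ A ↔ G.IsSlot a := by simp [hAdef]
  have hadj : ∀ a, G.IsSlot a → ∀ y, G.Adj a y ↔ y = hub a ∨ y = mid a := by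
    intro a ha y
    rw [← mem_neighborFinset, (hdata a ha).2.2.2.1]; simp
  have hadjm : ∀ a, G.IsSlot a → ∀ y, G.Adj (mid a) y ↔ y = mate a ∨ y = a := by
    intro a ha y
    rw [← mem_neighborFinset, (hdata a ha).2.2.2.2.2.2]; simp
  have hmate : ∀ a, G.IsSlot a → G.IsSlot (mate a) := fun a ha =>
    ⟨mid a, ((hadjm a ha _).2 (Or.inl rfl)).symm, (hdata a ha).2.1⟩
  have hdeg2 : ∀ a, G.IsSlot a → G.degree a = 2 := fun a ⟨b, hab, hb⟩ => hb.2 a hab.symm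
  -- The middle vertex is the only neighbor of degree two, the hub the only one of degree `k`.
  have hmiduniq : ∀ a, G.IsSlot a → ∀ y, G.Adj a y → G.degree y = 2 → y = mid a := by
    intro a ha y hy hy2
    rcases (hadj a ha y).1 hy with rfl | rfl
    · have := (hdata a ha).2.2.2.2.1; omega
    · rfl
  have hhubuniq : ∀ a, G.IsSlot a → ∀ y, G.Adj a y → G.degree y = k → y = hub a := by
    intro a ha y hy hyk
    rcases (hadj a ha y).1 hy with rfl | rfl
    · rfl
    · have := (hdata a ha).2.1.1; omega
  have hmm : ∀ a, G.IsSlot a → mid (mate a) = mid a := fun a ha =>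
    (hmiduniq _ (hmate a ha) _ ((hadjm a ha _).2 (Or.inl rfl)).symm (hdata a ha).2.1.1).symm
  have hmid : ∀ a, G.IsSlot a → ∀ a', G.IsSlot a' → mid a' = mid a → a' = a ∨ a' = mate a := by
    intro a ha a' ha' heq
    have := (hadjm a ha a').1 (heq ▸ (hdata a' ha').1.symm)
    tauto
  have hne : ∀ a, G.IsSlot a → mate a ≠ a := fun a ha => (hdata a ha).2.2.2.2.2.1
  have hinv : ∀ a, G.IsSlot a → mate (mate a) = a := by
    intro a ha
    rcases hmid _ (hmate a ha) a ha (hmm a ha).symm with h1 | h1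
    · exact absurd h1.symm (hne a ha)
    · exact h1.symm
  obtain ⟨X, hXA, hXne, hXmate, hXinj, hXinj', hXimg⟩ := exists_directed_cycles A
    (Finset.univ.filter fun v => G.degree v = k) hub mid mate
    (fun a ha => by simpa using (hdata a ((hA a).1 ha)).2.2.2.2.1)
    (fun a ha => (hA _).2 (hmate a ((hA a).1 ha)))
    (fun a ha => hne a ((hA a).1 ha)) (fun a ha => hinv a ((hA a).1 ha))
    (fun a ha => hmm a ((hA a).1 ha))
    (fun a ha a' ha' => hmid a ((hA a).1 ha) a' ((hA a').1 ha'))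
    (Finset.card_pos.1 (by omega)) hcard.le
  have hXs : ∀ a ∈ X, G.IsSlot a := fun a ha => (hA a).1 (hXA ha)
  set W := X ∪ X.image mate with hW
  have hWs : ∀ a ∈ W, G.IsSlot a := by
    intro a ha
    rcases Finset.mem_union.1 ha with ha | ha
    · exact hXs a ha
    · obtain ⟨b, hb, rfl⟩ := Finset.mem_image.1 ha
      exact hmate b (hXs b hb)
  have hWmate : ∀ a ∈ W, mate a ∈ W := by
    intro a ha
    rcases Finset.mem_union.1 ha with ha | ha
    · exact Finset.mem_union_right _ (Finset.mem_image_of_mem _ ha)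
    · obtain ⟨b, hb, rfl⟩ := Finset.mem_image.1 ha
      rw [hinv b (hXs b hb)]
      exact Finset.mem_union_left _ hb
  have hslotK : ∀ a, G.IsSlot a → a ∈ K := fun a ⟨b, hab, hb⟩ => (h.slot hk hab hb).1
  -- Deleting an edge at a recolored slot keeps all constraints between the other core vertices.
  obtain ⟨a₀, ha₀⟩ := hXne
  obtain ⟨C, hC⟩ := hcrit a₀ (mid a₀) (hdata a₀ (hXs a₀ ha₀)).1
  have hmidK : ∀ a, G.IsSlot a → mid a ∉ K := fun a ha => h.mid_notMem hk (hdata a ha).2.1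
  have hCW : G.square.IsListColoringOn L (K \ W) C := by
    have hav : ∀ v ∈ K \ W, v ≠ a₀ ∧ v ≠ mid a₀ := by
      intro v hv
      rw [Finset.mem_sdiff] at hv
      refine ⟨?_, ?_⟩
      · rintro rfl; exact hv.2 (Finset.mem_union_left _ ha₀)
      · rintro rfl; exact hmidK a₀ (hXs a₀ ha₀) hv.1
    refine ⟨fun v _ => hC.1 v (Finset.mem_univ v), fun u hu v hv huv => ?_⟩
    exact hC.2 u (Finset.mem_univ u) v (Finset.mem_univ v) (square_adj_deleteEdges huv
      (hav u hu).1 (hav u hu).2 (hav v hv).1 (hav v hv).2)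
  -- In the core, a slot sees its hub, the neighbors of its hub, and its mate.
  have hsq : ∀ a, G.IsSlot a → ∀ v ∈ K, G.square.Adj a v →
      v = hub a ∨ (G.Adj (hub a) v ∧ v ≠ a) ∨ v = mate a := by
    intro a ha v hvK hav
    obtain ⟨hnav, hav | ⟨w, haw, hwv⟩⟩ := square_adj_iff.1 hav
    · rcases (hadj a ha v).1 hav with rfl | rfl
      · exact Or.inl rfl
      · exact absurd hvK (hmidK a ha)
    · rcases (hadj a ha w).1 haw with rfl | rfl
      · exact Or.inr (Or.inl ⟨hwv, hnav.symm⟩)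
      · rcases (hadjm a ha v).1 hwv with rfl | rfl
        · exact Or.inr (Or.inr rfl)
        · exact absurd rfl hnav
  have hhubadj : ∀ a, G.IsSlot a → G.Adj a (hub a) := fun a ha => (hadj a ha _).2 (Or.inl rfl)
  have hhubk : ∀ a, G.IsSlot a → G.degree (hub a) = k := fun a ha => (hdata a ha).2.2.2.2.1
  classical
  obtain ⟨C', hC'⟩ := hCW.extend_of_bipartite_orientation
    (fun s s' => (s ∈ X ∧ s' = mate s) ∨ (s ∉ X ∧ s' ∈ X ∧ hub s' = hub s)) (· ∈ X)
    (by
      rintro s s' (⟨hs, rfl⟩ | ⟨hs, hs', -⟩)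
      · simpa [hs] using hXmate s hs
      · simp [hs, hs'])
    (by
      intro s hs s' hs' hss
      have hs'' := hWs s' hs'
      rcases hsq s (hWs s hs) s' (hslotK _ hs'') hss with rfl | ⟨hadj', hne'⟩ | rfl
      · have h1 := hhubk s (hWs s hs)
        have h2 := hdeg2 _ hs''
        omega
      · have heq : hub s = hub s' := hhubuniq s' hs'' _ hadj'.symm (hhubk s (hWs s hs))
        by_cases hsX : s ∈ X <;> by_cases hs'X : s' ∈ X
        · exact absurd (hXinj hs'X hsX heq.symm) hne'
        · exact Or.inr (Or.inr ⟨hs'X, hsX, heq⟩)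
        · exact Or.inl (Or.inr ⟨hsX, hs'X, heq.symm⟩)
        · have hm : ∀ s ∈ W, s ∉ X → ∃ r ∈ X, mate r = s := by
            intro s hs hsX
            exact Finset.mem_image.1 ((Finset.mem_union.1 hs).resolve_left hsX)
          obtain ⟨r, hr, rfl⟩ := hm s hs hsX
          obtain ⟨r', hr', rfl⟩ := hm s' hs' hs'X
          exact absurd (congrArg mate (hXinj' hr' hr heq.symm)) hne'
      · rcases Finset.mem_union.1 hs with hsX | hsX
        · exact Or.inl (Or.inl ⟨hsX, rfl⟩)
        · obtain ⟨r, hr, rfl⟩ := Finset.mem_image.1 hsX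
          refine Or.inr (Or.inl ⟨?_, ?_⟩)
          · rwa [hinv r (hXs r hr)]
          · rw [hinv r (hXs r hr)])
    (by
      intro s hs
      have hss := hWs s hs
      have hout : (W.filter fun s' => (s ∈ X ∧ s' = mate s) ∨
          (s ∉ X ∧ s' ∈ X ∧ hub s' = hub s)).card ≤ 1 := by
        rw [Finset.card_le_one]
        intro p hp q hq
        rcases (Finset.mem_filter.1 hp).2 with ⟨h1, rfl⟩ | ⟨h1, hpX, hp'⟩ <;>
          rcases (Finset.mem_filter.1 hq).2 with ⟨h2, rfl⟩ | ⟨h2, hqX, hq'⟩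
        · rfl
        · exact absurd h1 h2
        · exact absurd h2 h1
        · exact hXinj hpX hqX (hp'.trans hq'.symm)
      -- The second slot on the cycle at the same hub is not colored yet.
      obtain ⟨y, hyW, hys, hyhub⟩ : ∃ y ∈ W, y ≠ s ∧ hub y = hub s := by
        rcases Finset.mem_union.1 hs with hsX | hsX
        · have : hub s ∈ X.image (hub ∘ mate) := hXimg ▸ Finset.mem_image_of_mem _ hsX
          obtain ⟨r, hr, hrs⟩ := Finset.mem_image.1 this
          refine ⟨mate r, Finset.mem_union_right _ (Finset.mem_image_of_mem _ hr), ?_, hrs⟩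
          rintro rfl
          exact hXmate r hr hsX
        · obtain ⟨r, hr, rfl⟩ := Finset.mem_image.1 hsX
          have : hub (mate r) ∈ X.image hub :=
            hXimg ▸ Finset.mem_image_of_mem (hub ∘ mate) hr
          obtain ⟨p, hp, hpr⟩ := Finset.mem_image.1 this
          refine ⟨p, Finset.mem_union_left _ hp, ?_, hpr⟩
          rintro rfl
          exact hXmate r hr hp
      have hsub : G.square.neighborFinset s ∩ (K \ W) ⊆
          insert (hub s) (((G.neighborFinset (hub s)).erase s).erase y) := by
        intro v hv
        rw [Finset.mem_inter, mem_neighborFinset, Finset.mem_sdiff] at hv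
        rcases hsq s hss v hv.2.1 hv.1 with rfl | ⟨h1, h2⟩ | rfl
        · exact Finset.mem_insert_self _ _
        · refine Finset.mem_insert_of_mem ?_
          have : v ≠ y := by rintro rfl; exact hv.2.2 hyW
          simp [this, h2, h1]
        · exact absurd (hWmate s hs) hv.2.2
      have h1 := (Finset.card_le_card hsub).trans (Finset.card_insert_le _ _)
      have h2 : s ∈ G.neighborFinset (hub s) := by simpa using (hhubadj s hss).symm
      have h3 : y ∈ (G.neighborFinset (hub s)).erase s := by
        simp [hys, ← hyhub, (hhubadj y (hWs y hyW)).symm]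
      rw [Finset.card_erase_of_mem h3, Finset.card_erase_of_mem h2,
        card_neighborFinset_eq_degree, hhubk s hss] at h1
      have h4 := hL s
      omega)
  exact hK C' hC'

/-- A graph that is critical for coloring its square from lists of size `k + 1` is reduced with
respect to the core of its square, and has few slots. -/
theorem exists_isReduced {k : ℕ} (hk : 6 ≤ k) (hdeg : ∀ v, G.degree v ≤ k)
    [DecidablePred G.IsSlot] {L : V → Finset ℕ} (hL : ∀ v, k + 1 ≤ (L v).card)
    (hcrit : ∀ x y, G.Adj x y →
      ∃ C, (G.deleteEdges {s(x, y)}).square.IsListColoringOn L Finset.univ C)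
    (hG : ∀ C, ¬ G.square.IsListColoringOn L Finset.univ C) :
    ∃ K : Finset V, G.IsReduced k K ∧ (Finset.univ.filter G.IsSlot).card ≤
      2 * (Finset.univ.filter fun v => G.degree v = k).card := by
  classical
  obtain ⟨K, hcore, hext⟩ := exists_core G.square k L hL
  have hK : ∀ C, ¬ G.square.IsListColoringOn L K C := fun C hC =>
    (hext C hC).elim fun C' hC' => hG C' hC'
  have hred : G.IsReduced k K := by
    refine ⟨hdeg, fun v hv => (hcore v hv).trans (card_square_inter_le hv), ?_⟩
    intro x hx y hxy
    by_contra hcon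
    -- Otherwise deleting the edge `xy` loses no constraint between vertices of the core.
    obtain ⟨C, hC⟩ := hcrit x y hxy
    refine hK C ⟨fun v _ => hC.1 v (Finset.mem_univ v), fun u hu v hv huv =>
      hC.2 u (Finset.mem_univ u) v (Finset.mem_univ v) ?_⟩
    have hux : u ≠ x := by rintro rfl; exact hx hu
    have hvx : v ≠ x := by rintro rfl; exact hx hv
    rw [square_adj_iff] at huv ⊢
    refine ⟨huv.1, ?_⟩
    rcases huv.2 with h | ⟨w, h, h'⟩
    · exact Or.inl (by simp [deleteEdges_adj, h, hux, hvx])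
    · refine Or.inr ⟨w, ?_, ?_⟩
      · simp only [deleteEdges_adj, h, Set.mem_singleton_iff, true_and, Sym2.eq_iff, hux,
          false_and, false_or, not_and]
        rintro rfl rfl
        exact hcon ⟨hu, v, hv, huv.1.symm, h'⟩
      · simp only [deleteEdges_adj, h', Set.mem_singleton_iff, true_and, Sym2.eq_iff, hvx,
          and_false, or_false, not_and]
        rintro rfl rfl
        exact hcon ⟨hv, u, hu, huv.1, h.symm⟩
  exact ⟨K, hred, hred.card_slot_le hk hL hcrit hK⟩

end Critical

/-! ### Discharging -/

/-- The charge that a vertex of degree at most `k - 2` with `n` neighbors in the core gives to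
each of these neighbors; `δ` stands for `1 / (k - 2)`. For `n ≥ 3`, the total given is the initial
charge of a vertex of degree `n`. -/
noncomputable def coreShare (δ : ℝ) (n : ℕ) : ℝ :=
  if 3 ≤ n then 5 / 4 + 3 * δ - (7 / 2 + 6 * δ) / n else 0

lemma coreShare_of_three_le {δ : ℝ} {n : ℕ} (hn : 3 ≤ n) :
    coreShare δ n = 5 / 4 + 3 * δ - (7 / 2 + 6 * δ) / n := if_pos hn

lemma coreShare_nonneg {δ : ℝ} (hδ : 0 < δ) (n : ℕ) : 0 ≤ coreShare δ n := by
  unfold coreShare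
  split_ifs with h
  · have hn : (3 : ℝ) ≤ n := by exact_mod_cast h
    have : (7 / 2 + 6 * δ) / n ≤ 5 / 4 + 3 * δ := by
      rw [div_le_iff₀ (by linarith)]
      nlinarith
    linarith
  · rfl

lemma coreShare_mono {δ : ℝ} (hδ : 0 < δ) {m n : ℕ} (hmn : m ≤ n) :
    coreShare δ m ≤ coreShare δ n := by
  by_cases h : 3 ≤ m
  · rw [coreShare_of_three_le h, coreShare_of_three_le (h.trans hmn)]
    have hm : (3 : ℝ) ≤ m := by exact_mod_cast h
    have : (m : ℝ) ≤ n := by exact_mod_cast hmn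
    gcongr
  · rw [coreShare, if_neg h]
    exact coreShare_nonneg hδ n

/-- Two shares add up to `c` if the numbers of core neighbors satisfy a linear-fractional bound;
here `D = 1 / δ`. -/
lemma le_coreShare_add {D c : ℝ} (hD : 0 < D) {m n : ℕ} (hm : 3 ≤ m) (hn : 3 ≤ n)
    (h : (7 * D + 12) * (m + n) ≤ (5 * D + 12 - 2 * c * D) * (m * n)) :
    c ≤ coreShare (1 / D) m + coreShare (1 / D) n := by
  rw [coreShare_of_three_le hm, coreShare_of_three_le hn]
  have hm' : (0 : ℝ) < m := by exact_mod_cast (by omega : 0 < m)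
  have hn' : (0 : ℝ) < n := by exact_mod_cast (by omega : 0 < n)
  have : 5 / 4 + 3 * (1 / D) - (7 / 2 + 6 * (1 / D)) / m +
      (5 / 4 + 3 * (1 / D) - (7 / 2 + 6 * (1 / D)) / n) - c =
      ((5 * D + 12 - 2 * c * D) * (m * n) - (7 * D + 12) * (m + n)) / (2 * D * (m * n)) := by
    field_simp
    ring
  have h2 : 0 ≤ ((5 * D + 12 - 2 * c * D) * (m * n) - (7 * D + 12) * (m + n)) /
      (2 * D * ((m : ℝ) * n)) := div_nonneg (by linarith) (by positivity)
  linarith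

lemma one_le_coreShare_add {k : ℕ} (hk : 6 ≤ k) {m n : ℕ}
    (hm : 3 ≤ m) (hn : 3 ≤ n) (hmn : k + 1 ≤ m + n) :
    1 ≤ coreShare (1 / ((k : ℝ) - 2)) m + coreShare (1 / ((k : ℝ) - 2)) n := by
  have hk' : (6 : ℝ) ≤ k := by exact_mod_cast hk
  have hm' : (3 : ℝ) ≤ m := by exact_mod_cast hm
  have hn' : (3 : ℝ) ≤ n := by exact_mod_cast hn
  have hs : (k : ℝ) + 1 ≤ m + n := by exact_mod_cast hmn
  refine le_coreShare_add (by linarith) hm hn ?_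
  have h1 : 0 ≤ ((m : ℝ) - 3) * (n - 3) := mul_nonneg (by linarith) (by linarith)
  have h2 : 0 ≤ ((k : ℝ) + 2) * (((m : ℝ) - 3) * (n - 3)) := mul_nonneg (by linarith) h1
  have h3 : 0 ≤ ((k : ℝ) + 10) * (m + n - (k + 1)) := mul_nonneg (by linarith) (by linarith)
  nlinarith

lemma half_le_coreShare_add {k : ℕ} (hk : 6 ≤ k) {m n : ℕ}
    (hm : m + 2 ≤ k) (hn : n + 2 ≤ k) (hmn : k ≤ m + n) :
    1 / 2 - 2 * (1 / ((k : ℝ) - 2)) ≤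
      coreShare (1 / ((k : ℝ) - 2)) m + coreShare (1 / ((k : ℝ) - 2)) n := by
  have hk' : (6 : ℝ) ≤ k := by exact_mod_cast hk
  have hD : (0 : ℝ) < (k : ℝ) - 2 := by linarith
  have hδ : 0 < 1 / ((k : ℝ) - 2) := by positivity
  have hδ4 : 1 / ((k : ℝ) - 2) ≤ 1 / 4 := one_div_le_one_div_of_le (by norm_num) (by linarith)
  -- If one of the numbers is `2`, the other is `k - 2`, and its share alone suffices.
  have hlarge : 1 / 2 - 2 * (1 / ((k : ℝ) - 2)) ≤ coreShare (1 / ((k : ℝ) - 2)) (k - 2) := by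
    rw [coreShare_of_three_le (by omega), Nat.cast_sub (by omega), Nat.cast_ofNat,
      div_eq_mul_one_div (7 / 2 + 6 * (1 / ((k : ℝ) - 2)))]
    nlinarith
  by_cases hm3 : 3 ≤ m
  · by_cases hn3 : 3 ≤ n
    · refine le_coreShare_add hD hm3 hn3 ?_
      have hm' : (3 : ℝ) ≤ m := by exact_mod_cast hm3
      have hn' : (3 : ℝ) ≤ n := by exact_mod_cast hn3
      have hs : (k : ℝ) ≤ m + n := by exact_mod_cast hmn
      have : 5 * ((k : ℝ) - 2) + 12 - 2 * (1 / 2 - 2 * (1 / ((k : ℝ) - 2))) * (k - 2) =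
          4 * k + 8 := by
        field_simp
        ring
      rw [this]
      have h1 : 0 ≤ ((m : ℝ) - 3) * (n - 3) := mul_nonneg (by linarith) (by linarith)
      have h2 : 0 ≤ ((k : ℝ) + 2) * (((m : ℝ) - 3) * (n - 3)) := mul_nonneg (by linarith) h1
      have h3 : 0 ≤ (5 * (k : ℝ) + 26) * (m + n - k) := mul_nonneg (by linarith) (by linarith)
      nlinarith
    · obtain rfl : m = k - 2 := by omega
      linarith [coreShare_nonneg hδ n]
  · obtain rfl : n = k - 2 := by omega
    linarith [coreShare_nonneg hδ m]

section Discharging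

variable {V : Type*} [Fintype V] [DecidableEq V] (G : SimpleGraph V) [DecidableRel G.Adj]

open scoped Classical in
/-- The charge sent from `x` to its neighbor `y`. A vertex of degree `k - 1` or `k` sends `5 / 4 - δ`
along each edge, but `3 / 2` to a slot. A vertex of degree between `3` and `k - 2` sends `3 / 4 + δ`
to each neighbor of degree two off the core and `coreShare` to each core neighbor. Of two adjacent
vertices of degree two, the one in the core passes on what it does not need. -/
noncomputable def flow (k : ℕ) (δ : ℝ) (K : Finset V) (x y : V) : ℝ :=
  if k ≤ G.degree x + 1 then
    if G.degree x = k ∧ G.IsSlot y then 3 / 2 else 5 / 4 - δ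
  else if 3 ≤ G.degree x then
    if y ∈ K then coreShare δ (G.coreDegree K x)
    else if G.degree y = 2 then 3 / 4 + δ else 0
  else if G.degree y = 2 ∧ x ∈ K ∧ y ∉ K then
    if G.IsMid y then 1 / 2 else 1 / 4 - δ
  else 0

/-- The initial charge of a vertex of degree `d`; it is chosen such that the total charge is
negative when the average degree is less than `2 + (4 * k - 8) / (5 * k + 2)`, and such that a
vertex of degree two has charge `-1`. -/
noncomputable def initialCharge (δ : ℝ) (d : ℕ) : ℝ := ((d : ℝ) - 2) * (5 / 4 + 3 * δ) - 1

variable {G} {k : ℕ} {δ : ℝ} {K : Finset V}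

lemma flow_nonneg (hδ : 0 < δ) (hδ4 : δ ≤ 1 / 4) (x y : V) : 0 ≤ G.flow k δ K x y := by
  have := coreShare_nonneg hδ (G.coreDegree K x)
  unfold flow
  split_ifs <;> linarith

lemma le_flow_of_le (hδ : 0 < δ) {x : V} (hx : k ≤ G.degree x + 1) (y : V) :
    5 / 4 - δ ≤ G.flow k δ K x y := by
  unfold flow
  rw [if_pos hx]
  split_ifs <;> linarith

lemma flow_of_mem {x y : V} (hx : ¬ k ≤ G.degree x + 1) (hx3 : 3 ≤ G.degree x) (hy : y ∈ K) :
    G.flow k δ K x y = coreShare δ (G.coreDegree K x) := by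
  rw [flow, if_neg hx, if_pos hx3, if_pos hy]

lemma flow_of_notMem {x y : V} (hx : ¬ k ≤ G.degree x + 1) (hx3 : 3 ≤ G.degree x)
    (hy : y ∉ K) (hy2 : G.degree y = 2) : G.flow k δ K x y = 3 / 4 + δ := by
  rw [flow, if_neg hx, if_pos hx3, if_neg hy, if_pos hy2]

lemma flow_of_degree_two (hk : 6 ≤ k) {x y : V} (hx : G.degree x = 2)
    (h : ¬ (G.degree y = 2 ∧ x ∈ K ∧ y ∉ K)) : G.flow k δ K x y = 0 := by
  rw [flow, if_neg (by omega), if_neg (by omega), if_neg h]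

lemma coreReach_le_coreDegree (K : Finset V) (v : V) : G.coreReach K v ≤ G.coreDegree K v := by
  unfold coreReach
  split_ifs <;> omega

lemma IsReduced.two_le_degree (h : G.IsReduced k K) {x y : V} (hxy : G.Adj x y) :
    2 ≤ G.degree x := by
  by_contra! hlt
  have h1 : 0 < G.degree x := (G.degree_pos_iff_exists_adj x).2 ⟨y, hxy⟩
  obtain ⟨w, hw⟩ := Finset.card_eq_one.1 (show (G.neighborFinset x).card = 1 by
    rw [card_neighborFinset_eq_degree]; omega)
  have hadj : ∀ z, G.Adj x z → z = w := by
    intro z hz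
    have : z ∈ G.neighborFinset x := by simpa using hz
    simpa [hw] using this
  by_cases hx : x ∈ K
  · have h2 := h.le_sum_coreReach x hx
    rw [hw, Finset.sum_singleton] at h2
    have h3 := coreReach_le_degree (G := G) K w
    have h4 := h.degree_le w
    omega
  · obtain ⟨-, z, -, hzy, hz⟩ := h.of_notMem x hx y hxy
    exact hzy ((hadj z hz).trans (hadj y hxy).symm)

lemma initialCharge_two : initialCharge δ 2 = -1 := by
  simp [initialCharge]

/-- Final charge of a vertex of degree two with exactly one neighbor of degree two. -/
lemma IsReduced.charge_thread (h : G.IsReduced k K) (hk : 6 ≤ k) (hδ : 0 < δ) (hδ4 : δ ≤ 1 / 4)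
    {a u w : V} (huw : u ≠ w) (ha : G.neighborFinset a = {u, w}) (ha2 : G.degree a = 2)
    (hu : 3 ≤ G.degree u) (hw : G.degree w = 2) :
    0 ≤ -1 + (G.flow k δ K u a + G.flow k δ K w a) - (G.flow k δ K a u + G.flow k δ K a w) := by
  have hau : G.Adj a u := by rw [← mem_neighborFinset, ha]; simp
  have haw : G.Adj a w := by rw [← mem_neighborFinset, ha]; simp
  have hreach : a ∈ K → k + 1 ≤ G.coreReach K u + G.coreReach K w := by
    intro haK
    have := h.le_sum_coreReach a haK
    rwa [ha, Finset.sum_pair huw] at this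
  have hru := coreReach_le_degree (G := G) K u
  have hrw := coreReach_le_degree (G := G) K w
  have hdu := h.degree_le u
  rw [flow_of_degree_two hk ha2 (by omega : ¬ (G.degree u = 2 ∧ _))]
  have hfw := flow_nonneg (G := G) (k := k) (K := K) hδ hδ4 w a
  by_cases hwK : w ∈ K
  · rw [flow_of_degree_two hk ha2 (by simp [hwK])]
    by_cases haK : a ∈ K
    · have := hreach haK
      have := le_flow_of_le (G := G) (K := K) hδ (by omega : k ≤ G.degree u + 1) a
      linarith
    · have hmid : ¬ G.IsMid a := fun hm => by have := hm.2 u hau; omega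
      have h1 : G.flow k δ K w a = 1 / 4 - δ := by
        rw [flow, if_neg (by omega), if_neg (by omega), if_pos ⟨ha2, hwK, haK⟩, if_neg hmid]
      by_cases hbig : k ≤ G.degree u + 1
      · have := le_flow_of_le (G := G) (K := K) hδ hbig a
        linarith
      · rw [flow_of_notMem hbig hu haK ha2]
        linarith
  · have haK : a ∈ K := (h.of_notMem w hwK a haw.symm).1
    have hrw' : G.coreReach K w ≤ 1 := by
      have := coreDegree_le_degree (G := G) K w
      rw [coreReach, if_neg hwK]
      omega
    have := hreach haK
    have hdk : G.degree u = k := by omega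
    by_cases hm : G.IsMid w
    · have h1 : G.flow k δ K u a = 3 / 2 := by
        rw [flow, if_pos (by omega), if_pos ⟨hdk, w, haw, hm⟩]
      have h2 : G.flow k δ K a w = 1 / 2 := by
        rw [flow, if_neg (by omega), if_neg (by omega), if_pos ⟨hw, haK, hwK⟩, if_pos hm]
      linarith
    · have h1 := le_flow_of_le (G := G) (K := K) hδ (by omega : k ≤ G.degree u + 1) a
      have h2 : G.flow k δ K a w = 1 / 4 - δ := by
        rw [flow, if_neg (by omega), if_neg (by omega), if_pos ⟨hw, haK, hwK⟩, if_neg hm]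
      linarith

lemma IsReduced.charge_of_degree_two (h : G.IsReduced k K) (hk : 6 ≤ k)
    (hδk : δ = 1 / ((k : ℝ) - 2)) (hδ : 0 < δ) (hδ4 : δ ≤ 1 / 4)
    {a : V} (ha2 : G.degree a = 2) :
    0 ≤ initialCharge δ (G.degree a) + ∑ y ∈ G.neighborFinset a, G.flow k δ K y a -
      ∑ y ∈ G.neighborFinset a, G.flow k δ K a y := by
  obtain ⟨u, w, huw, ha⟩ := Finset.card_eq_two.1 ha2
  change G.neighborFinset a = _ at ha
  have hau : G.Adj a u := by rw [← mem_neighborFinset, ha]; simp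
  have haw : G.Adj a w := by rw [← mem_neighborFinset, ha]; simp
  rw [ha2, initialCharge_two, ha, Finset.sum_pair huw, Finset.sum_pair huw]
  have hdu := h.two_le_degree hau.symm
  have hdw := h.two_le_degree haw.symm
  rcases hdu.eq_or_lt with hu | hu <;> rcases hdw.eq_or_lt with hw | hw
  · have hm : G.IsMid a := by
      refine ⟨ha2, fun y hy => ?_⟩
      rw [← mem_neighborFinset, ha, Finset.mem_insert, Finset.mem_singleton] at hy
      rcases hy with rfl | rfl <;> omega
    have haK := h.mid_notMem hk hm
    have huK := (h.of_notMem a haK u hau).1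
    have hwK := (h.of_notMem a haK w haw).1
    rw [flow_of_degree_two hk ha2 (by simp [huK]), flow_of_degree_two hk ha2 (by simp [hwK])]
    rw [flow, if_neg (by omega), if_neg (by omega), if_pos ⟨ha2, huK, haK⟩, if_pos hm,
      flow, if_neg (by omega), if_neg (by omega), if_pos ⟨ha2, hwK, haK⟩, if_pos hm]
    norm_num
  · have := h.charge_thread hk hδ hδ4 huw.symm (by rw [ha, Finset.pair_comm]) ha2 hw hu.symm
    linarith
  · exact h.charge_thread hk hδ hδ4 huw ha ha2 hu hw.symm
  · rw [flow_of_degree_two hk ha2 (by omega : ¬ (G.degree u = 2 ∧ _)),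
      flow_of_degree_two hk ha2 (by omega : ¬ (G.degree w = 2 ∧ _))]
    have hfu := flow_nonneg (G := G) (k := k) (K := K) hδ hδ4 u a
    have hfw := flow_nonneg (G := G) (k := k) (K := K) hδ hδ4 w a
    by_cases hbu : k ≤ G.degree u + 1
    · have := le_flow_of_le (G := G) (K := K) hδ hbu a
      linarith
    by_cases hbw : k ≤ G.degree w + 1
    · have := le_flow_of_le (G := G) (K := K) hδ hbw a
      linarith
    by_cases haK : a ∈ K
    · rw [flow_of_mem hbu hu haK, flow_of_mem hbw hw haK]
      have h1 := h.le_sum_coreReach a haK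
      rw [ha, Finset.sum_pair huw] at h1
      have h2 := coreReach_le_coreDegree (G := G) K u
      have h3 := coreReach_le_coreDegree (G := G) K w
      have h4 := coreDegree_le_degree (G := G) K u
      have h5 := coreDegree_le_degree (G := G) K w
      have := one_le_coreShare_add hk (m := G.coreDegree K u) (n := G.coreDegree K w)
        (by omega) (by omega) (by omega)
      rw [← hδk] at this
      linarith
    · rw [flow_of_notMem hbu hu haK ha2, flow_of_notMem hbw hw haK ha2]
      linarith

end Discharging

section Discharging

variable {V : Type*} [Fintype V] [DecidableEq V] {G : SimpleGraph V} [DecidableRel G.Adj]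
  {k : ℕ} {δ : ℝ} {K : Finset V}

/-- Final charge of a vertex of medium degree. The hard case is a vertex `x` with at most two
neighbors in the core. Its neighbors of degree two off the core show it at most one core vertex
each in the square, so its other neighbors have many core neighbors and send it much charge. -/
lemma IsReduced.charge_of_medium_degree (h : G.IsReduced k K) (hk : 6 ≤ k)
    (hδk : δ = 1 / ((k : ℝ) - 2)) (hδ : 0 < δ) (hδ4 : δ ≤ 1 / 4)
    {x : V} (hx3 : 3 ≤ G.degree x) (hxk : ¬ k ≤ G.degree x + 1) :
    0 ≤ initialCharge δ (G.degree x) + ∑ y ∈ G.neighborFinset x, G.flow k δ K y x -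
      ∑ y ∈ G.neighborFinset x, G.flow k δ K x y := by
  set N := G.neighborFinset x with hN
  set d := G.degree x with hd
  set N1 := N.filter fun y => y ∉ K ∧ G.degree y = 2 with hN1
  set κ := G.coreDegree K x with hκ
  have hκN : κ = (N.filter (· ∈ K)).card := by
    rw [hκ, coreDegree, Finset.filter_mem_eq_inter]
  have hcardN : N.card = d := G.card_neighborFinset_eq_degree x
  have hd' : (3 : ℝ) ≤ d := by exact_mod_cast hx3
  have hout : ∑ y ∈ N, G.flow k δ K x y = κ * coreShare δ κ + N1.card * (3 / 4 + δ) := by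
    have : ∀ y ∈ N, G.flow k δ K x y = (if y ∈ K then coreShare δ κ else 0) +
        (if y ∉ K ∧ G.degree y = 2 then 3 / 4 + δ else 0) := by
      intro y _
      rw [flow, if_neg hxk, if_pos hx3]
      by_cases hy : y ∈ K <;> simp [hy, hκ]
    rw [Finset.sum_congr rfl this, Finset.sum_add_distrib, ← Finset.sum_filter,
      ← Finset.sum_filter, Finset.sum_const, Finset.sum_const, ← hκN, nsmul_eq_mul, nsmul_eq_mul]
  have hin : ∀ y ∈ N, 0 ≤ G.flow k δ K y x := fun y _ => flow_nonneg hδ hδ4 y x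
  have hin0 : 0 ≤ ∑ y ∈ N, G.flow k δ K y x := Finset.sum_nonneg hin
  have hκN1 : κ + N1.card ≤ d := by
    rw [hκN, ← hcardN, ← Finset.card_filter_add_card_filter_not (s := N) (· ∈ K)]
    refine Nat.add_le_add_left (Finset.card_le_card fun y hy => ?_) _
    rw [hN1, Finset.mem_filter] at hy
    exact Finset.mem_filter.2 ⟨hy.1, hy.2.1⟩
  have hcast : (κ : ℝ) + N1.card ≤ d := by exact_mod_cast hκN1
  have hN1nonneg : (0 : ℝ) ≤ N1.card := Nat.cast_nonneg _
  rw [hout]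
  unfold initialCharge
  by_cases hκ3 : 3 ≤ κ
  · have hκ3' : (3 : ℝ) ≤ κ := by exact_mod_cast hκ3
    have : (κ : ℝ) * coreShare δ κ = κ * (5 / 4 + 3 * δ) - (7 / 2 + 6 * δ) := by
      rw [coreShare_of_three_le hκ3]
      field_simp
    rw [this]
    have h1 : 0 ≤ ((d : ℝ) - κ - N1.card) * (5 / 4 + 3 * δ) :=
      mul_nonneg (by linarith) (by linarith)
    have h2 : 0 ≤ (N1.card : ℝ) * (1 / 2 + 2 * δ) := by positivity
    nlinarith
  have hshare : coreShare δ κ = 0 := by rw [coreShare, if_neg hκ3]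
  rw [hshare, mul_zero, zero_add]
  have hxK : x ∈ K := by
    by_contra hxK
    have : N.filter (· ∈ K) = N := Finset.filter_true_of_mem fun y hy =>
      (h.of_notMem x hxK y (by simpa [hN] using hy)).1
    rw [this] at hκN
    omega
  by_cases hbig : ∃ y ∈ N, k ≤ G.degree y + 1
  · obtain ⟨y, hy, hyk⟩ := hbig
    have h1 : 5 / 4 - δ ≤ ∑ y ∈ N, G.flow k δ K y x :=
      (le_flow_of_le hδ hyk x).trans (Finset.single_le_sum hin hy)
    have h2 : N1.card < d := by
      rw [← hcardN]
      refine Finset.card_lt_card ((Finset.ssubset_iff_of_subset (Finset.filter_subset _ _)).2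
        ⟨y, hy, fun hy1 => ?_⟩)
      have := (Finset.mem_filter.1 hy1).2.2
      omega
    have h3 : (N1.card : ℝ) ≤ d - 1 := by
      have : (N1.card : ℝ) + 1 ≤ d := by exact_mod_cast h2
      linarith
    have h4 : (N1.card : ℝ) * (3 / 4 + δ) ≤ (d - 1) * (3 / 4 + δ) := by gcongr
    have h5 : 0 ≤ ((d : ℝ) - 3) * (1 / 2 + 2 * δ) := mul_nonneg (by linarith) (by linarith)
    nlinarith
  push Not at hbig
  -- `O` is the set of the neighbors that need no charge from `x`.
  set O := N.filter fun y => ¬ (y ∉ K ∧ G.degree y = 2) with hO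
  have hON : O ⊆ N := Finset.filter_subset _ _
  have hsplit : N1.card + O.card = d := by
    rw [← hcardN]; exact Finset.card_filter_add_card_filter_not _
  have hsplit' : (N1.card : ℝ) = d - O.card := by
    have : (N1.card : ℝ) + O.card = d := by exact_mod_cast hsplit
    linarith
  have hreach : k + 1 ≤ N1.card + ∑ y ∈ O, G.coreReach K y := by
    have h1 := h.le_sum_coreReach x hxK
    rw [← hN, ← Finset.sum_filter_add_sum_filter_not N (fun y => y ∉ K ∧ G.degree y = 2)] at h1
    have h2 : ∑ y ∈ N1, G.coreReach K y ≤ N1.card • 1 := by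
      refine Finset.sum_le_card_nsmul _ _ _ fun y hy => ?_
      obtain ⟨hyK, hy2⟩ := (Finset.mem_filter.1 hy).2
      have := coreDegree_le_degree (G := G) K y
      rw [coreReach, if_neg hyK]
      omega
    rw [smul_eq_mul, mul_one] at h2
    exact h1.trans (Nat.add_le_add_right h2 _)
  have hflow : ∀ y ∈ O, coreShare δ (G.coreReach K y) ≤ G.flow k δ K y x := by
    intro y hy
    have hyN := hON hy
    by_cases hy3 : 3 ≤ G.degree y
    · rw [flow_of_mem (by have := hbig y hyN; omega) hy3 hxK]
      exact coreShare_mono hδ (coreReach_le_coreDegree K y)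
    · have := coreReach_le_degree (G := G) K y
      rw [coreShare, if_neg (by omega)]
      exact hin y hyN
  have hinO : ∑ y ∈ O, coreShare δ (G.coreReach K y) ≤ ∑ y ∈ N, G.flow k δ K y x :=
    (Finset.sum_le_sum hflow).trans (Finset.sum_le_sum_of_subset_of_nonneg hON
      fun y hy _ => hin y hy)
  have hrle : ∀ y ∈ O, G.coreReach K y + 2 ≤ k := by
    intro y hy
    have := hbig y (hON hy)
    have := coreReach_le_degree (G := G) K y
    omega
  have hslack : ((d : ℝ) - 2) * (5 / 4 + 3 * δ) - 1 - N1.card * (3 / 4 + δ) =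
      (d - 2) * (1 / 2 + 2 * δ) - 1 + (O.card - 2) * (3 / 4 + δ) := by
    rw [hsplit']; ring
  have hk' : (6 : ℝ) ≤ k := by exact_mod_cast hk
  rcases Nat.lt_or_ge 1 O.card with hO2 | hO1
  · have hO2' : (2 : ℝ) ≤ O.card := by exact_mod_cast hO2
    have h1 : 0 ≤ ((O.card : ℝ) - 2) * (3 / 4 + δ) := mul_nonneg (by linarith) (by linarith)
    by_cases hd4 : 4 ≤ d
    · have hd4' : (4 : ℝ) ≤ d := by exact_mod_cast hd4
      nlinarith
    · have hd3 : d = 3 := by omega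
      have hd3' : (d : ℝ) = 3 := by exact_mod_cast hd3
      by_cases hO3 : O.card = 2
      · obtain ⟨y, z, hyz, hyz'⟩ := Finset.card_eq_two.1 hO3
        rw [hyz', Finset.sum_pair hyz] at hinO hreach
        have := half_le_coreShare_add hk (hrle y (by simp [hyz'])) (hrle z (by simp [hyz']))
          (by omega)
        rw [← hδk] at this
        rw [hd3'] at hslack ⊢
        linarith
      · have hO3' : (3 : ℝ) ≤ O.card := by exact_mod_cast (by omega : 3 ≤ O.card)
        have h1 : 0 ≤ ((O.card : ℝ) - 3) * (3 / 4 + δ) := mul_nonneg (by linarith) (by linarith)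
        rw [hd3'] at hslack ⊢
        nlinarith
  · have hO1' : O.card = 1 := by
      rcases Nat.eq_zero_or_pos O.card with h0 | h0
      · rw [Finset.card_eq_zero.1 h0, Finset.sum_empty] at hreach
        omega
      · omega
    obtain ⟨y, hy⟩ := Finset.card_eq_one.1 hO1'
    rw [hy, Finset.sum_singleton] at hinO hreach
    have hry := hrle y (by simp [hy])
    set r := G.coreReach K y with hr
    have hd4 : 4 ≤ d := by omega
    have hr4 : (4 : ℝ) ≤ r := by exact_mod_cast (by omega : 4 ≤ r)
    rw [coreShare_of_three_le (by omega)] at hinO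
    rw [hO1'] at hslack
    have hgoal : (7 / 2 + 6 * δ) / r ≤ ((d : ℝ) - 3) * (1 / 2 + 2 * δ) + 4 * δ := by
      rcases hd4.eq_or_lt with hd4 | hd5
      · have hrk : (r : ℝ) = k - 2 := by
          rw [eq_sub_iff_add_eq]
          exact_mod_cast (by omega : r + 2 = k)
        have hδr : δ * r = 1 := by
          rw [hrk, hδk]
          exact div_mul_cancel₀ _ (by linarith)
        rw [div_le_iff₀ (by linarith), ← hd4]
        push_cast
        nlinarith
      · have hd5' : (5 : ℝ) ≤ d := by exact_mod_cast hd5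
        have h1 : (7 / 2 + 6 * δ) / r ≤ (7 / 2 + 6 * δ) / 4 := by gcongr
        have h2 : 0 ≤ ((d : ℝ) - 5) * (1 / 2 + 2 * δ) := mul_nonneg (by linarith) (by linarith)
        nlinarith
    push_cast at hslack
    nlinarith

lemma charge_of_degree_succ_eq (hk : 6 ≤ k) (hδk : δ = 1 / ((k : ℝ) - 2)) (hδ : 0 < δ)
    (hδ4 : δ ≤ 1 / 4) {x : V} (hx : G.degree x + 1 = k) :
    0 ≤ initialCharge δ (G.degree x) + ∑ y ∈ G.neighborFinset x, G.flow k δ K y x -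
      ∑ y ∈ G.neighborFinset x, G.flow k δ K x y := by
  have hk' : (6 : ℝ) ≤ k := by exact_mod_cast hk
  have hin0 : 0 ≤ ∑ y ∈ G.neighborFinset x, G.flow k δ K y x :=
    Finset.sum_nonneg fun y _ => flow_nonneg hδ hδ4 y x
  have hout : ∑ y ∈ G.neighborFinset x, G.flow k δ K x y = G.degree x * (5 / 4 - δ) := by
    rw [← card_neighborFinset_eq_degree, ← nsmul_eq_mul, ← Finset.sum_const]
    refine Finset.sum_congr rfl fun y _ => ?_
    rw [flow, if_pos (by omega), if_neg (by omega)]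
  have hd : (G.degree x : ℝ) = k - 1 := by
    rw [eq_sub_iff_add_eq]; exact_mod_cast hx
  have hδk' : δ * (k - 2) = 1 := by
    rw [hδk]; exact div_mul_cancel₀ _ (by linarith)
  rw [hout, initialCharge, hd]
  nlinarith

open scoped Classical in
lemma charge_of_degree_eq (hk : 6 ≤ k) (hδk : δ = 1 / ((k : ℝ) - 2)) (hδ : 0 < δ)
    (hδ4 : δ ≤ 1 / 4) {x : V} (hx : G.degree x = k) :
    (1 / 2 + 2 * δ) - (1 / 4 + δ) * ((G.neighborFinset x).filter G.IsSlot).card ≤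
      initialCharge δ (G.degree x) + ∑ y ∈ G.neighborFinset x, G.flow k δ K y x -
      ∑ y ∈ G.neighborFinset x, G.flow k δ K x y := by
  have hk' : (6 : ℝ) ≤ k := by exact_mod_cast hk
  have hin0 : 0 ≤ ∑ y ∈ G.neighborFinset x, G.flow k δ K y x :=
    Finset.sum_nonneg fun y _ => flow_nonneg hδ hδ4 y x
  have hout : ∑ y ∈ G.neighborFinset x, G.flow k δ K x y = k * (5 / 4 - δ) +
      (1 / 4 + δ) * ((G.neighborFinset x).filter G.IsSlot).card := by
    have : ∀ y ∈ G.neighborFinset x, G.flow k δ K x y =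
        (5 / 4 - δ) + if G.IsSlot y then 1 / 4 + δ else 0 := by
      intro y _
      rw [flow, if_pos (by omega)]
      by_cases hy : G.IsSlot y
      · rw [if_pos ⟨hx, hy⟩, if_pos hy]; ring
      · rw [if_neg (fun h => hy h.2), if_neg hy, add_zero]
    rw [Finset.sum_congr rfl this, Finset.sum_add_distrib, ← Finset.sum_filter, Finset.sum_const,
      Finset.sum_const, card_neighborFinset_eq_degree, hx, nsmul_eq_mul, nsmul_eq_mul]
    ring
  have hδk' : δ * (k - 2) = 1 := by
    rw [hδk]; exact div_mul_cancel₀ _ (by linarith)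
  rw [hout, initialCharge, hx]
  nlinarith

open scoped Classical in
/-- The average degree of the nontrivial part of a reduced graph with few slots is large. -/
theorem IsReduced.le_sum_degree (h : G.IsReduced k K) (hk : 6 ≤ k)
    (hslot : (Finset.univ.filter G.IsSlot).card ≤
      2 * (Finset.univ.filter fun v => G.degree v = k).card) :
    (2 + (4 * (k : ℝ) - 8) / (5 * k + 2)) * (Finset.univ.filter fun v => 0 < G.degree v).card ≤
      ∑ v, (G.degree v : ℝ) := by
  have hk' : (6 : ℝ) ≤ k := by exact_mod_cast hk
  have hD : (0 : ℝ) < (k : ℝ) - 2 := by linarith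
  obtain ⟨δ, hδk⟩ : ∃ δ : ℝ, δ = 1 / ((k : ℝ) - 2) := ⟨_, rfl⟩
  have hδ : 0 < δ := by rw [hδk]; positivity
  have hδ4 : δ ≤ 1 / 4 := by
    rw [hδk]; exact one_div_le_one_div_of_le (by norm_num) (by linarith)
  set S := Finset.univ.filter fun v => 0 < G.degree v with hS
  set B := Finset.univ.filter fun v => G.degree v = k with hB
  have hswap : ∑ v ∈ S, ∑ y ∈ G.neighborFinset v, G.flow k δ K y v =
      ∑ v ∈ S, ∑ y ∈ G.neighborFinset v, G.flow k δ K v y := by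
    refine Finset.sum_comm' fun x y => ?_
    have : ∀ u v, G.Adj u v → 0 < G.degree u := fun u v huv =>
      (G.degree_pos_iff_exists_adj u).2 ⟨v, huv⟩
    simp only [hS, Finset.mem_filter, Finset.mem_univ, true_and, mem_neighborFinset]
    exact ⟨fun h => ⟨h.2.symm, this _ _ h.2.symm⟩, fun h => ⟨this _ _ h.1.symm, h.1.symm⟩⟩
  have hslotdeg : ∑ v ∈ B, (((G.neighborFinset v).filter G.IsSlot).card : ℝ) ≤ 2 * B.card := by
    have h1 : ∑ v ∈ B, ((G.neighborFinset v).filter G.IsSlot).card ≤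
        (Finset.univ.filter G.IsSlot).card := by
      rw [← Finset.card_biUnion]
      · exact Finset.card_le_card (Finset.biUnion_subset.2 fun v _ =>
          Finset.filter_subset_filter _ (Finset.subset_univ _))
      · intro v hv w hw hvw
        refine Finset.disjoint_left.2 fun a ha ha' => ?_
        simp only [Finset.mem_filter, mem_neighborFinset] at ha ha'
        obtain ⟨b, hab, hb⟩ := ha.2
        obtain ⟨-, -, u, hub, hu, -⟩ := h.slot hk hab hb
        have key : ∀ v ∈ B, G.Adj v a → v = u := by
          intro v hv hva
          have hmem : v ∈ G.neighborFinset a := by simpa using hva.symm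
          rw [hu, Finset.mem_insert, Finset.mem_singleton] at hmem
          rcases hmem with rfl | rfl
          · rfl
          · have h1 := (Finset.mem_filter.1 hv).2
            have h2 := hb.1
            omega
        exact hvw ((key v hv ha.1).trans (key w hw ha'.1).symm)
    exact_mod_cast h1.trans hslot
  have hfinal : ∑ v ∈ S, (if G.degree v = k then (1 / 2 + 2 * δ) -
      (1 / 4 + δ) * (((G.neighborFinset v).filter G.IsSlot).card : ℝ) else 0) ≤
      ∑ v ∈ S, (initialCharge δ (G.degree v) + ∑ y ∈ G.neighborFinset v, G.flow k δ K y v -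
        ∑ y ∈ G.neighborFinset v, G.flow k δ K v y) := by
    refine Finset.sum_le_sum fun v hv => ?_
    obtain ⟨y, hy⟩ := (G.degree_pos_iff_exists_adj v).1 (Finset.mem_filter.1 hv).2
    have h2 := h.two_le_degree hy
    have hvk := h.degree_le v
    split_ifs with hk1
    · exact charge_of_degree_eq hk hδk hδ hδ4 hk1
    · by_cases hk2 : G.degree v + 1 = k
      · exact charge_of_degree_succ_eq hk hδk hδ hδ4 hk2
      · by_cases h3 : 3 ≤ G.degree v
        · exact h.charge_of_medium_degree hk hδk hδ hδ4 h3 (by omega)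
        · exact h.charge_of_degree_two hk hδk hδ hδ4 (by omega)
  have hBS : S.filter (fun v => G.degree v = k) = B := by
    ext v
    simp only [hS, hB, Finset.mem_filter, Finset.mem_univ, true_and, and_iff_right_iff_imp]
    omega
  rw [← Finset.sum_filter, hBS, Finset.sum_sub_distrib, ← Finset.mul_sum, Finset.sum_const,
    nsmul_eq_mul, Finset.sum_sub_distrib, Finset.sum_add_distrib, hswap, add_sub_cancel_right]
    at hfinal
  have hnonneg : 0 ≤ ∑ v ∈ S, initialCharge δ (G.degree v) := by
    have : (1 / 4 + δ) * ∑ v ∈ B, (((G.neighborFinset v).filter G.IsSlot).card : ℝ) ≤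
      (1 / 4 + δ) * (2 * B.card) := by gcongr
    linarith
  have hsum : ∑ v ∈ S, (G.degree v : ℝ) = ∑ v, (G.degree v : ℝ) := by
    refine Finset.sum_subset (Finset.subset_univ _) fun v _ hv => ?_
    have : G.degree v = 0 := by simpa [hS] using hv
    simp [this]
  simp only [initialCharge] at hnonneg
  rw [Finset.sum_sub_distrib, ← Finset.sum_mul, Finset.sum_sub_distrib, hsum, Finset.sum_const,
    Finset.sum_const, nsmul_eq_mul, nsmul_eq_mul] at hnonneg
  have heq : 2 + (4 * (k : ℝ) - 8) / (5 * k + 2) = (7 / 2 + 6 * δ) / (5 / 4 + 3 * δ) := by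
    rw [hδk]
    have : (5 / 4 + 3 * (1 / ((k : ℝ) - 2))) = (5 * k + 2) / (4 * (k - 2)) := by
      field_simp; ring
    rw [this]
    field_simp
    ring
  rw [heq, div_mul_eq_mul_div, div_le_iff₀ (by linarith)]
  linarith

end Discharging

/-! ### The choice number of the square -/

lemma le_mad {V : Type*} [Finite V] {G : SimpleGraph V} (H : G.Subgraph) (hH : H.verts.Nonempty) :
    2 * (H.edgeSet.ncard : ℝ) / (H.verts.ncard : ℝ) ≤ G.mad :=
  le_ciSup (f := fun H : {H : G.Subgraph // H.verts.Nonempty} =>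
    2 * (H.1.edgeSet.ncard : ℝ) / (H.1.verts.ncard : ℝ)) (Set.finite_range _).bddAbove ⟨H, hH⟩

theorem isChoosable_square_of_mad_lt {V : Type*} [Fintype V] (G : SimpleGraph V)
    [DecidableRel G.Adj] {k : ℕ} (hk : 6 ≤ k) (hdeg : G.maxDegree ≤ k)
    (hmad : G.mad < 2 + (4 * (k : ℝ) - 8) / (5 * (k : ℝ) + 2)) :
    G.square.IsChoosable (k + 1) := by
  classical
  intro L hL
  by_contra hcon
  -- A minimal spanning subgraph whose square has no coloring from the lists is critical.
  obtain ⟨H, hH⟩ : ∃ H : SimpleGraph V, Minimal (fun H : SimpleGraph V =>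
      H ≤ G ∧ ¬ ∃ C, H.square.IsListColoringOn L Finset.univ C) H := by
    refine Set.Finite.exists_minimal (Set.toFinite _) ⟨G, le_rfl, ?_⟩
    rintro ⟨C, hC⟩
    exact hcon ⟨Coloring.mk C fun {u v} huv =>
      hC.2 u (Finset.mem_univ u) v (Finset.mem_univ v) huv, fun v => hC.1 v (Finset.mem_univ v)⟩
  obtain ⟨hHG, hHcol⟩ := hH.prop
  have hcrit : ∀ x y, H.Adj x y →
      ∃ C, (H.deleteEdges {s(x, y)}).square.IsListColoringOn L Finset.univ C := by
    intro x y hxy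
    by_contra hno
    have := hH.le_of_le ⟨(deleteEdges_le _).trans hHG, hno⟩ (deleteEdges_le _) hxy
    simp [deleteEdges_adj] at this
  have hHdeg : ∀ v, H.degree v ≤ k := fun v =>
    (degree_le_of_le hHG).trans ((G.degree_le_maxDegree v).trans hdeg)
  obtain ⟨K, hred, hslot⟩ := exists_isReduced hk hHdeg hL hcrit (by simpa using hHcol)
  have hsum := hred.le_sum_degree hk hslot
  have hedges : (∑ v, (H.degree v : ℝ)) = 2 * (H.edgeSet.ncard : ℝ) := by
    have := H.sum_degrees_eq_twice_card_edges
    rw [Set.ncard_eq_toFinset_card', ← edgeFinset]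
    exact_mod_cast this
  obtain ⟨a, b, hab⟩ : ∃ a b, H.Adj a b := by
    by_contra! hno
    refine hHcol ⟨fun v => (L v).min' (Finset.card_pos.1 ((Nat.succ_pos k).trans_le (hL v))),
      fun v _ => Finset.min'_mem _ _, fun u _ v _ huv => ?_⟩
    rcases (square_adj_iff.1 huv).2 with h | ⟨w, h, -⟩
    · exact absurd h (hno _ _)
    · exact absurd h (hno _ _)
  set S := Finset.univ.filter fun v => 0 < H.degree v with hS
  have haS : a ∈ S := by simp [hS, H.degree_pos_iff_exists_adj]; exact ⟨b, hab⟩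
  let H' : G.Subgraph :=
    { verts := S
      Adj := H.Adj
      adj_sub := fun h => hHG h
      edge_vert := fun {v w} h => by simp [hS, H.degree_pos_iff_exists_adj]; exact ⟨w, h⟩
      symm := H.symm }
  have hedge' : H'.edgeSet = H.edgeSet := by
    ext e
    induction e using Sym2.ind with
    | _ x y => rfl
  have hmad' := le_mad H' ⟨a, haS⟩
  have hverts : (H'.verts.ncard : ℝ) = S.card := by
    rw [show H'.verts = (S : Set V) from rfl, Set.ncard_coe_finset]
  rw [hedge', ← hedges, hverts, div_le_iff₀ (by exact_mod_cast Finset.card_pos.2 ⟨a, haS⟩)] at hmad'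
  have hpos : (0 : ℝ) < S.card := by exact_mod_cast Finset.card_pos.2 ⟨a, haS⟩
  have := mul_lt_mul_of_pos_right hmad hpos
  linarith

lemma choiceNumber_le {V : Type*} {G : SimpleGraph V} {n : ℕ} (h : G.IsChoosable n) :
    G.choiceNumber ≤ n :=
  iInf₂_le (f := fun (k : ℕ) (_ : k ∈ {n : ℕ | G.IsChoosable n}) => (k : ℕ∞)) n h

/-- A closed neighborhood is a clique of the square. -/
lemma degree_add_one_le_choiceNumber_square {V : Type*} [Fintype V] (G : SimpleGraph V)
    [DecidableRel G.Adj] (v : V) : (G.degree v : ℕ∞) + 1 ≤ G.square.choiceNumber := by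
  classical
  refine le_iInf₂ fun n hn => ?_
  obtain ⟨C, hC⟩ := hn (fun _ => Finset.range n) (fun _ => by simp)
  have hclique : ∀ u ∈ insert v (G.neighborFinset v), ∀ w ∈ insert v (G.neighborFinset v),
      u ≠ w → G.square.Adj u w := by
    intro u hu w hw huw
    rw [Finset.mem_insert, mem_neighborFinset] at hu hw
    refine square_adj_iff.2 ⟨huw, ?_⟩
    rcases hu with rfl | hu <;> rcases hw with rfl | hw
    · exact absurd rfl huw
    · exact Or.inl hw
    · exact Or.inl hu.symm
    · exact Or.inr ⟨v, hu.symm, hw⟩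
  have h1 : (insert v (G.neighborFinset v)).card ≤ (Finset.range n).card := by
    refine Finset.card_le_card_of_injOn C (fun u _ => hC u) fun u hu w hw huw => ?_
    by_contra hne
    exact C.valid (hclique u hu w hw hne) huw
  rw [Finset.card_insert_of_notMem (by simp), card_neighborFinset_eq_degree,
    Finset.card_range] at h1
  exact_mod_cast h1

theorem choiceNumber_square_eq_of_mad_lt {V : Type*} [Fintype V] (G : SimpleGraph V)
    [DecidableRel G.Adj] (hdeg : 6 ≤ G.maxDegree)
    (hmad : G.mad < 2 + (4 * (G.maxDegree : ℝ) - 8) / (5 * (G.maxDegree : ℝ) + 2)) :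
    G.square.choiceNumber = (G.maxDegree : ℕ∞) + 1 := by
  refine le_antisymm ?_ ?_
  · exact_mod_cast choiceNumber_le (isChoosable_square_of_mad_lt G hdeg le_rfl hmad)
  · have : Nonempty V := by
      by_contra hV
      rw [not_nonempty_iff] at hV
      have := G.maxDegree_of_subsingleton
      omega
    obtain ⟨v, hv⟩ := G.exists_maximal_degree_vertex
    rw [hv]
    exact degree_add_one_le_choiceNumber_square G v

/-! ### Faces of a system of plane segments -/

/-- A family of plane segments, none of them vertical, that meet in common endpoints only. Distinct
endpoints have distinct abscissas. -/
structure SegmentSystem (S : Type*) where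
  /-- The left endpoint of a segment. -/
  left : S → ℝ × ℝ
  /-- The right endpoint of a segment. -/
  right : S → ℝ × ℝ
  left_lt_right : ∀ s, (left s).1 < (right s).1
  generic : ∀ s t, ∀ p, (p = left s ∨ p = right s) → ∀ q, (q = left t ∨ q = right t) →
    p.1 = q.1 → p = q
  inter : ∀ s t, s ≠ t → ∀ z ∈ segment ℝ (left s) (right s) ∩ segment ℝ (left t) (right t),
    z = left s ∨ z = right s

namespace SegmentSystem

variable {S : Type*} (M : SegmentSystem S)

/-- The slope of a segment. -/
noncomputable def slope (s : S) : ℝ :=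
  ((M.right s).2 - (M.left s).2) / ((M.right s).1 - (M.left s).1)

/-- The ordinate at abscissa `x` of the line through a segment. -/
noncomputable def height (s : S) (x : ℝ) : ℝ := (M.left s).2 + (x - (M.left s).1) * M.slope s

@[simp] lemma height_left (s : S) : M.height s (M.left s).1 = (M.left s).2 := by simp [height]

@[simp] lemma height_right (s : S) : M.height s (M.right s).1 = (M.right s).2 := by
  have := sub_ne_zero.2 (M.left_lt_right s).ne'
  rw [height, slope]
  field_simp
  ring

lemma height_eq_of_right (s : S) (x : ℝ) :
    M.height s x = (M.right s).2 + (x - (M.right s).1) * M.slope s := by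
  have h := M.height_right s
  rw [height] at h ⊢
  linarith

lemma continuous_height (s : S) : Continuous (M.height s) := by
  unfold height
  fun_prop

lemma mem_segment {s : S} {x : ℝ} (h1 : (M.left s).1 ≤ x) (h2 : x ≤ (M.right s).1) :
    (x, M.height s x) ∈ segment ℝ (M.left s) (M.right s) := by
  have h := sub_pos.2 (M.left_lt_right s)
  rw [segment_eq_image']
  refine ⟨(x - (M.left s).1) / ((M.right s).1 - (M.left s).1),
    ⟨div_nonneg (by linarith) h.le, (div_le_one h).2 (by linarith)⟩, ?_⟩
  ext
  · simp [h.ne']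
  · simp only [height, slope, Prod.snd_add, Prod.smul_snd, Prod.snd_sub, smul_eq_mul]
    ring

/-- Two segments have different heights above an interior abscissa of one of them. -/
lemma height_ne {s t : S} (hst : s ≠ t) {x : ℝ} (hs1 : (M.left s).1 < x) (hs2 : x < (M.right s).1)
    (ht1 : (M.left t).1 ≤ x) (ht2 : x ≤ (M.right t).1) : M.height s x ≠ M.height t x := by
  intro h
  have hz := (M.inter s t hst (x, M.height s x)
    ⟨M.mem_segment hs1.le hs2.le, by rw [h]; exact M.mem_segment ht1 ht2⟩)
  rcases hz with hz | hz
  · rw [← hz] at hs1; exact lt_irrefl _ hs1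
  · rw [← hz] at hs2; exact lt_irrefl _ hs2

lemma eq_of_left_eq_of_slope_eq {s t : S} (hl : M.left s = M.left t)
    (hs : M.slope s = M.slope t) : s = t := by
  by_contra hst
  have hst' : M.height s = M.height t := by funext x; rw [height, height, hl, hs]
  set x := min (M.right s).1 (M.right t).1 with hx
  have h1 : (M.left s).1 < x := lt_min (M.left_lt_right s) (hl ▸ M.left_lt_right t)
  obtain ⟨y, hy1, hy2⟩ := exists_between h1
  have hys := hy2.trans_le (min_le_left _ _)
  have hyt := hy2.trans_le (min_le_right _ _)
  exact M.height_ne hst hy1 hys (hl ▸ hy1.le) hyt.le (by rw [hst'])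

lemma eq_of_right_eq_of_slope_eq {s t : S} (hl : M.right s = M.right t)
    (hs : M.slope s = M.slope t) : s = t := by
  by_contra hst
  have hst' : M.height s = M.height t := by
    funext x; rw [height_eq_of_right, height_eq_of_right, hl, hs]
  set x := max (M.left s).1 (M.left t).1 with hx
  have h1 : x < (M.right s).1 := max_lt (M.left_lt_right s) (hl ▸ M.left_lt_right t)
  obtain ⟨y, hy1, hy2⟩ := exists_between h1
  have hys := (le_max_left _ _).trans_lt hy1
  have hyt := (le_max_right _ _).trans_lt hy1
  exact M.height_ne hst hys hy2 hyt.le (hl ▸ hy2.le) (by rw [hst'])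

/-- Segment `t` passes above segment `s` at abscissa `x`. Abscissas of left endpoints count, those
of right endpoints do not. -/
def IsAbove (s : S) (x : ℝ) (t : S) : Prop :=
  (M.left t).1 ≤ x ∧ x < (M.right t).1 ∧ M.height s x < M.height t x

open Filter Topology

/-- When the abscissa passes `x₀`, the segments above `s` change only at endpoints above `s`. -/
lemma eventually_isAbove {s : S} {x₀ : ℝ} (h1 : (M.left s).1 < x₀) (h2 : x₀ < (M.right s).1)
    (t : S) : ∀ᶠ x in 𝓝 x₀, (M.IsAbove s x t ↔
      if x < x₀ then (M.IsAbove s x₀ t ∧ (M.left t).1 ≠ x₀) ∨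
        ((M.right t).1 = x₀ ∧ M.height s x₀ < (M.right t).2)
      else M.IsAbove s x₀ t) := by
  by_cases hst : s = t
  · subst hst
    filter_upwards with x
    simp [IsAbove, h2.ne']
  rcases lt_or_ge x₀ (M.left t).1 with hl | hl
  · filter_upwards [gt_mem_nhds hl] with x hx
    have := hl.trans (M.left_lt_right t)
    simp [IsAbove, hx.not_ge, hl.not_ge, this.ne']
  rcases lt_or_ge (M.right t).1 x₀ with hr | hr
  · filter_upwards [lt_mem_nhds hr] with x hx
    simp [IsAbove, hx.not_gt, hr.not_gt, hr.ne]
  have hne := M.height_ne hst h1 h2 hl hr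
  have hcs := (M.continuous_height s).tendsto x₀
  have hct := (M.continuous_height t).tendsto x₀
  have hsign : ∀ᶠ x in 𝓝 x₀, (M.height s x < M.height t x ↔ M.height s x₀ < M.height t x₀) := by
    rcases hne.lt_or_gt with h | h
    · filter_upwards [hcs.eventually_lt hct h] with x hx
      simp [hx, h]
    · filter_upwards [hct.eventually_lt hcs h] with x hx
      simp [hx.not_gt, h.not_gt]
  rcases hl.eq_or_lt with hl | hl
  · have hr' : x₀ < (M.right t).1 := hl ▸ M.left_lt_right t
    filter_upwards [hsign, gt_mem_nhds hr'] with x hx hxr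
    by_cases hxx : x < x₀
    · simp [IsAbove, hxx, hl, hr'.ne', hxx.not_ge]
    · simp [IsAbove, hxx, hx, hxr, hr', hl, not_lt.1 hxx]
  · rcases hr.eq_or_lt with hr | hr
    · have hrr : M.height t x₀ = (M.right t).2 := by rw [hr, height_right]
      filter_upwards [hsign, lt_mem_nhds hl] with x hx hxl
      by_cases hxx : x < x₀
      · simp [IsAbove, hxx, hx, hxl.le, ← hr, hrr]
      · simp [IsAbove, hxx, ← hr]
    · filter_upwards [hsign, lt_mem_nhds hl, gt_mem_nhds hr] with x hx hxl hxr
      simp [IsAbove, hx, hxl.le, hl.le, hxr, hr, hl.ne, hr.ne']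

variable [Fintype S]

open scoped Classical in
/-- The parity of the number of segments of `Z` above `s` at abscissa `x`. -/
noncomputable def parityAbove (Z : S → ZMod 2) (s : S) (x : ℝ) : ZMod 2 :=
  ∑ t, if M.IsAbove s x t then Z t else 0

open scoped Classical in
/-- A set of segments, given by its indicator function, is even if every point is an endpoint of an
even number of its segments. -/
def IsEven (Z : S → ZMod 2) : Prop :=
  ∀ p, (∑ s with M.left s = p, Z s) + ∑ s with M.right s = p, Z s = 0

/-- The parity above a segment does not change along the segment. -/
lemma parityAbove_eq {Z : S → ZMod 2} (hZ : M.IsEven Z) {s : S} {x y : ℝ}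
    (hx : x ∈ Set.Ioo (M.left s).1 (M.right s).1) (hy : y ∈ Set.Ioo (M.left s).1 (M.right s).1) :
    M.parityAbove Z s x = M.parityAbove Z s y := by
  classical
  refine isPreconnected_Ioo.constant (f := M.parityAbove Z s) (fun x₀ hx₀ => ?_) hx hy
  refine (ContinuousAt.continuousWithinAt ?_)
  rw [ContinuousAt, nhds_discrete (ZMod 2), tendsto_pure]
  filter_upwards [eventually_all.2 fun t => M.eventually_isAbove hx₀.1 hx₀.2 t] with x hx
  by_cases hxx : x < x₀
  · simp only [hxx, if_true] at hx
    have hterm : ∀ t, (if M.IsAbove s x t then Z t else 0) =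
        (if M.IsAbove s x₀ t then Z t else 0) +
        ((if (M.left t).1 = x₀ ∧ M.height s x₀ < (M.left t).2 then Z t else 0) +
          if (M.right t).1 = x₀ ∧ M.height s x₀ < (M.right t).2 then Z t else 0) := by
      intro t
      have hlr := M.left_lt_right t
      rw [if_congr (hx t) rfl rfl]
      by_cases hl : (M.left t).1 = x₀
      · have hr : (M.right t).1 ≠ x₀ := by rw [← hl]; exact hlr.ne'
        have hab : M.IsAbove s x₀ t ↔ M.height s x₀ < (M.left t).2 := by
          simp [IsAbove, ← hl, hlr]
        simp only [hl, hr, hab, false_and, ne_eq, not_true_eq_false, and_false, or_self, if_false,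
          true_and, add_zero]
        exact (CharTwo.add_self_eq_zero _).symm
      · by_cases hr : (M.right t).1 = x₀
        · have hab : ¬ M.IsAbove s x₀ t := by simp [IsAbove, ← hr]
          simp [hl, hr, hab]
        · simp [hl, hr]
    simp only [parityAbove]
    rw [Finset.sum_congr rfl fun t _ => hterm t, Finset.sum_add_distrib, add_eq_left,
      Finset.sum_add_distrib]
    by_cases hp : ∃ p, p.1 = x₀ ∧ ∃ t, p = M.left t ∨ p = M.right t
    · obtain ⟨p, hpx, t₀, hpt⟩ := hp
      have hl : ∀ t, (M.left t).1 = x₀ ↔ M.left t = p := fun t =>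
        ⟨fun h => (M.generic t t₀ _ (Or.inl rfl) p hpt (h.trans hpx.symm)), fun h => h ▸ hpx⟩
      have hr : ∀ t, (M.right t).1 = x₀ ↔ M.right t = p := fun t =>
        ⟨fun h => (M.generic t t₀ _ (Or.inr rfl) p hpt (h.trans hpx.symm)), fun h => h ▸ hpx⟩
      have hl' : ∀ t, ((M.left t).1 = x₀ ∧ M.height s x₀ < (M.left t).2) ↔
          (M.left t = p ∧ M.height s x₀ < p.2) := fun t => by
        rw [hl]; exact and_congr_right fun h => by rw [h]
      have hr' : ∀ t, ((M.right t).1 = x₀ ∧ M.height s x₀ < (M.right t).2) ↔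
          (M.right t = p ∧ M.height s x₀ < p.2) := fun t => by
        rw [hr]; exact and_congr_right fun h => by rw [h]
      by_cases hab : M.height s x₀ < p.2
      · simp only [hl', hr', hab, and_true]
        rw [← Finset.sum_filter, ← Finset.sum_filter]
        exact hZ p
      · simp [hl', hr', hab]
    · push Not at hp
      have hl : ∀ t, (M.left t).1 ≠ x₀ := fun t h => (hp _ h t).1 rfl
      have hr : ∀ t, (M.right t).1 ≠ x₀ := fun t h => (hp _ h t).2 rfl
      simp [hl, hr]
  · simp only [hxx, if_false] at hx
    simp only [parityAbove, hx]

end SegmentSystem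

/-- Telescoping along a linear order: the partial sums of `e`, taken from the top, start at `A` and
end at `A + ∑ e`, and all the others are counted twice. -/
lemma sum_indicator_telescope {S F : Type*} [DecidableEq S] [AddCommGroup F] [DecidableEq F]
    (R : Finset S) (σ : S → ℝ) (hσ : ∀ s ∈ R, ∀ t ∈ R, σ s = σ t → s = t) (e : S → F) (A f : F) :
    ∑ s ∈ R, ((if A + ∑ t ∈ R with σ s < σ t, e t = f then (1 : ZMod 2) else 0) +
      if A + ∑ t ∈ R with σ s < σ t, e t + e s = f then 1 else 0) =
    (if A = f then 1 else 0) + if A + ∑ s ∈ R, e s = f then 1 else 0 := by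
  induction R using Finset.induction_on_min_value σ with
  | empty => simp [CharTwo.add_self_eq_zero]
  | insert a R ha hmin ih =>
    have hlt : ∀ t ∈ R, σ a < σ t := fun t ht => (hmin t ht).lt_of_ne fun h => ha
      ((hσ a (by simp) t (by simp [ht]) h) ▸ ht)
    have h1 : (insert a R).filter (fun t => σ a < σ t) = R := by
      rw [Finset.filter_insert, if_neg (lt_irrefl _), Finset.filter_true_of_mem hlt]
    have h2 : ∀ s ∈ R, (insert a R).filter (fun t => σ s < σ t) =
        R.filter fun t => σ s < σ t := by
      intro s hs
      rw [Finset.filter_insert, if_neg (hlt s hs).not_gt]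
    have h3 := ih fun s hs t ht => hσ s (by simp [hs]) t (by simp [ht])
    have h4 : ∑ s ∈ R, ((if A + ∑ t ∈ insert a R with σ s < σ t, e t = f then (1 : ZMod 2) else 0) +
        if A + ∑ t ∈ insert a R with σ s < σ t, e t + e s = f then 1 else 0) =
        (if A = f then 1 else 0) + if A + ∑ s ∈ R, e s = f then 1 else 0 := by
      rw [← h3]
      exact Finset.sum_congr rfl fun s hs => by rw [h2 s hs]
    rw [Finset.sum_insert ha, h4, h1, Finset.sum_insert ha, add_comm (e a)]
    generalize (if A + ∑ t ∈ R, e t = f then (1 : ZMod 2) else 0) = p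
    rw [← add_assoc A]
    generalize (if A + ∑ t ∈ R, e t + e a = f then (1 : ZMod 2) else 0) = q
    generalize (if A = f then (1 : ZMod 2) else 0) = r
    have := CharTwo.add_self_eq_zero p
    linear_combination this

namespace SegmentSystem

variable {S : Type*} (M : SegmentSystem S)

open Filter Topology

/-- Segment `t` passes above the point `p`. -/
def PassesAbove (p : ℝ × ℝ) (t : S) : Prop :=
  (M.left t).1 < p.1 ∧ p.1 < (M.right t).1 ∧ p.2 < M.height t p.1

/-- Just to the right of an endpoint `p`, the segments above a segment `s` that starts at `p` are
those passing above `p` and the steeper ones starting at `p`. -/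
lemma eventually_isAbove_right {s : S} {p : ℝ × ℝ} (hs : M.left s = p) (t : S) :
    ∀ᶠ x in 𝓝[>] p.1, (M.IsAbove s x t ↔
      M.PassesAbove p t ∨ (M.left t = p ∧ M.slope s < M.slope t)) := by
  have hlp : (M.left t).1 = p.1 → M.left t = p := fun h =>
    M.generic t s _ (Or.inl rfl) p (Or.inl hs.symm) h
  rcases lt_or_ge p.1 (M.left t).1 with hl | hl
  · filter_upwards [mem_nhdsWithin_of_mem_nhds (gt_mem_nhds hl)] with x hx
    have : M.left t ≠ p := fun h => by rw [h] at hl; exact lt_irrefl _ hl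
    simp [IsAbove, PassesAbove, hx.not_ge, hl.not_gt, this]
  rcases le_or_gt (M.right t).1 p.1 with hr | hr
  · filter_upwards [self_mem_nhdsWithin] with x hx
    have h1 : (M.right t).1 ≤ x := hr.trans (le_of_lt hx)
    have h2 : M.left t ≠ p := fun h => by
      have := M.left_lt_right t
      rw [h] at this
      exact this.not_ge hr
    simp [IsAbove, PassesAbove, h1.not_gt, hr.not_gt, h2]
  have hhs : M.height s p.1 = p.2 := by rw [← hs, height_left]
  rcases hl.eq_or_lt with hl | hl
  · have hl' := hlp hl
    filter_upwards [mem_nhdsWithin_of_mem_nhds (gt_mem_nhds hr), self_mem_nhdsWithin] with x hx hpx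
    have hpx' : 0 < x - p.1 := sub_pos.2 hpx
    have hpx'' : p.1 < x := hpx
    have : M.height s x < M.height t x ↔ M.slope s < M.slope t := by
      rw [height, height, hs, hl', add_lt_add_iff_left, mul_lt_mul_iff_right₀ hpx']
    simp [IsAbove, PassesAbove, hl', hpx''.le, hx, this]
  · have hlne : M.left t ≠ p := fun h => by rw [h] at hl; exact lt_irrefl _ hl
    have hst : t ≠ s := by rintro rfl; exact hlne hs
    have hne : M.height t p.1 ≠ p.2 := by
      rw [← hhs]
      refine M.height_ne hst hl hr ?_ ?_ <;> rw [← hs]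
      exact (M.left_lt_right s).le
    have hcs := (M.continuous_height s).tendsto p.1
    have hct := (M.continuous_height t).tendsto p.1
    have hsign : ∀ᶠ x in 𝓝 p.1, (M.height s x < M.height t x ↔ p.2 < M.height t p.1) := by
      rw [hhs] at hcs
      rcases hne.lt_or_gt with h | h
      · filter_upwards [hct.eventually_lt hcs h] with x hx
        simp [hx.not_gt, h.not_gt]
      · filter_upwards [hcs.eventually_lt hct h] with x hx
        simp [hx, h]
    filter_upwards [mem_nhdsWithin_of_mem_nhds hsign, mem_nhdsWithin_of_mem_nhds (gt_mem_nhds hr),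
      self_mem_nhdsWithin] with x hx hxr hpx
    simp [IsAbove, PassesAbove, hx, hxr, hl, hr, hlne, (hl.trans hpx).le]

/-- The mirror image of `eventually_isAbove_right`, for segments ending at `p`. -/
lemma eventually_isAbove_left {s : S} {p : ℝ × ℝ} (hs : M.right s = p) (t : S) :
    ∀ᶠ x in 𝓝[<] p.1, (M.IsAbove s x t ↔
      M.PassesAbove p t ∨ (M.right t = p ∧ -M.slope s < -M.slope t)) := by
  have hrp : (M.right t).1 = p.1 → M.right t = p := fun h =>
    M.generic t s _ (Or.inr rfl) p (Or.inr hs.symm) h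
  rcases lt_or_ge (M.right t).1 p.1 with hr | hr
  · filter_upwards [mem_nhdsWithin_of_mem_nhds (lt_mem_nhds hr)] with x hx
    have : M.right t ≠ p := fun h => by rw [h] at hr; exact lt_irrefl _ hr
    simp [IsAbove, PassesAbove, hx.not_gt, hr.not_gt, this]
  rcases le_or_gt p.1 (M.left t).1 with hl | hl
  · filter_upwards [self_mem_nhdsWithin] with x hx
    have h1 : x < (M.left t).1 := lt_of_lt_of_le hx hl
    have h2 : M.right t ≠ p := fun h => by
      have := M.left_lt_right t
      rw [h] at this
      exact this.not_ge hl
    simp [IsAbove, PassesAbove, h1.not_ge, hl.not_gt, h2]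
  have hhs : M.height s p.1 = p.2 := by rw [← hs, height_right]
  rcases hr.eq_or_lt with hr | hr
  · have hr' := hrp hr.symm
    filter_upwards [mem_nhdsWithin_of_mem_nhds (lt_mem_nhds hl), self_mem_nhdsWithin] with x hx hpx
    have hpx' : x - p.1 < 0 := sub_neg.2 hpx
    have : M.height s x < M.height t x ↔ M.slope t < M.slope s := by
      rw [height_eq_of_right, height_eq_of_right, hs, hr', add_lt_add_iff_left,
        mul_lt_mul_left_of_neg hpx']
    have hxp : x < p.1 := hpx
    simp [IsAbove, PassesAbove, hr', hx.le, hxp, this]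
  · have hrne : M.right t ≠ p := fun h => by rw [h] at hr; exact lt_irrefl _ hr
    have hst : t ≠ s := by rintro rfl; exact hrne hs
    have hne : M.height t p.1 ≠ p.2 := by
      rw [← hhs]
      refine M.height_ne hst hl hr ?_ ?_ <;> rw [← hs]
      exact (M.left_lt_right s).le
    have hcs := (M.continuous_height s).tendsto p.1
    have hct := (M.continuous_height t).tendsto p.1
    have hsign : ∀ᶠ x in 𝓝 p.1, (M.height s x < M.height t x ↔ p.2 < M.height t p.1) := by
      rw [hhs] at hcs
      rcases hne.lt_or_gt with h | h
      · filter_upwards [hct.eventually_lt hcs h] with x hx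
        simp [hx.not_gt, h.not_gt]
      · filter_upwards [hcs.eventually_lt hct h] with x hx
        simp [hx, h]
    filter_upwards [mem_nhdsWithin_of_mem_nhds hsign, mem_nhdsWithin_of_mem_nhds (lt_mem_nhds hl),
      self_mem_nhdsWithin] with x hx hxl hpx
    have hxp : x < p.1 := hpx
    simp [IsAbove, PassesAbove, hx, hxl.le, hl, hr, hrne, hxp.trans hr]

variable [Fintype S]

/-- The space of even sets of segments, over the field with two elements. -/
def evenSpace : Submodule (ZMod 2) (S → ZMod 2) where
  carrier := {Z | M.IsEven Z}
  zero_mem' := fun p => by simp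
  add_mem' := fun {Y Z} hY hZ p => by
    simp only [Pi.add_apply, Finset.sum_add_distrib]
    linear_combination hY p + hZ p
  smul_mem' := fun c Z hZ p => by
    simp only [Pi.smul_apply, smul_eq_mul, ← Finset.mul_sum]
    linear_combination c * hZ p

/-- The region just above a segment. A region of the plane is encoded by the function telling for
each even set of segments whether it has an odd number of members above the region. -/
noncomputable def upperFace (s : S) : M.evenSpace → ZMod 2 :=
  fun Z => M.parityAbove Z.1 s (((M.left s).1 + (M.right s).1) / 2)

/-- The region just below a segment. -/
noncomputable def lowerFace (s : S) : M.evenSpace → ZMod 2 :=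
  M.upperFace s + fun Z => Z.1 s

open scoped Classical in
/-- The indicator function of the boundary of a region: the segments with the region on exactly
one side. -/
noncomputable def faceBoundary (f : M.evenSpace → ZMod 2) (s : S) : ZMod 2 :=
  (if M.upperFace s = f then 1 else 0) + if M.lowerFace s = f then 1 else 0

lemma upperFace_apply (s : S) {x : ℝ} (hx : x ∈ Set.Ioo (M.left s).1 (M.right s).1)
    (Z : M.evenSpace) : M.upperFace s Z = M.parityAbove Z.1 s x := by
  have := M.left_lt_right s
  exact M.parityAbove_eq Z.2 ⟨by linarith, by linarith⟩ hx

/-- The region just above the point `p`. -/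
noncomputable def pointFace (p : ℝ × ℝ) : M.evenSpace → ZMod 2 := by
  classical exact fun Z => ∑ t, if M.PassesAbove p t then Z.1 t else 0

open scoped Classical in
lemma upperFace_eq_of_left {s : S} {p : ℝ × ℝ} (hs : M.left s = p) :
    M.upperFace s = M.pointFace p + ∑ t ∈ Finset.univ.filter (fun t => M.left t = p) with
      M.slope s < M.slope t, fun Z : M.evenSpace => Z.1 t := by
  have hlt : p.1 < (M.right s).1 := hs ▸ M.left_lt_right s
  obtain ⟨x, hx, hxr, hpx⟩ := ((eventually_all.2 fun t => M.eventually_isAbove_right hs t).and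
    ((eventually_nhdsWithin_of_eventually_nhds (gt_mem_nhds hlt)).and
      self_mem_nhdsWithin)).exists
  funext Z
  rw [M.upperFace_apply s ⟨hs ▸ hpx, hxr⟩, parityAbove, Pi.add_apply, pointFace,
    Finset.sum_apply, Finset.filter_filter, Finset.sum_filter, ← Finset.sum_add_distrib]
  refine Finset.sum_congr rfl fun t _ => ?_
  rw [if_congr (hx t) rfl rfl]
  by_cases h1 : M.PassesAbove p t
  · have h2 : M.left t ≠ p := fun h => by have := h1.1; rw [h] at this; exact lt_irrefl _ this
    simp [h1, h2]
  · simp [h1]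

open scoped Classical in
lemma upperFace_eq_of_right {s : S} {p : ℝ × ℝ} (hs : M.right s = p) :
    M.upperFace s = M.pointFace p + ∑ t ∈ Finset.univ.filter (fun t => M.right t = p) with
      -M.slope s < -M.slope t, fun Z : M.evenSpace => Z.1 t := by
  have hlt : (M.left s).1 < p.1 := hs ▸ M.left_lt_right s
  obtain ⟨x, hx, hxl, hpx⟩ := ((eventually_all.2 fun t => M.eventually_isAbove_left hs t).and
    ((eventually_nhdsWithin_of_eventually_nhds (lt_mem_nhds hlt)).and
      self_mem_nhdsWithin)).exists
  funext Z
  rw [M.upperFace_apply s ⟨hxl, hs ▸ hpx⟩, parityAbove, Pi.add_apply, pointFace,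
    Finset.sum_apply, Finset.filter_filter, Finset.sum_filter, ← Finset.sum_add_distrib]
  refine Finset.sum_congr rfl fun t _ => ?_
  rw [if_congr (hx t) rfl rfl]
  by_cases h1 : M.PassesAbove p t
  · have h2 : M.right t ≠ p := fun h => by have := h1.2.1; rw [h] at this; exact lt_irrefl _ this
    simp [h1, h2]
  · simp [h1]

/-- The boundary of a region is even: going around a point `p`, one crosses first the segments on
its right and then those on its left, each time passing from the region above `p` to the region
below. -/
lemma isEven_faceBoundary (f : M.evenSpace → ZMod 2) : M.IsEven (M.faceBoundary f) := by
  classical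
  intro p
  have hR : ∑ s with M.left s = p, M.faceBoundary f s =
      (if M.pointFace p = f then 1 else 0) +
        if M.pointFace p + ∑ s with M.left s = p, (fun Z : M.evenSpace => Z.1 s) = f
          then 1 else 0 := by
    rw [← sum_indicator_telescope (Finset.univ.filter fun s => M.left s = p) M.slope
      (fun s hs t ht => M.eq_of_left_eq_of_slope_eq
        ((Finset.mem_filter.1 hs).2.trans (Finset.mem_filter.1 ht).2.symm))]
    refine Finset.sum_congr rfl fun s hs => ?_
    rw [faceBoundary, lowerFace, M.upperFace_eq_of_left (Finset.mem_filter.1 hs).2]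
  have hL : ∑ s with M.right s = p, M.faceBoundary f s =
      (if M.pointFace p = f then 1 else 0) +
        if M.pointFace p + ∑ s with M.right s = p, (fun Z : M.evenSpace => Z.1 s) = f
          then 1 else 0 := by
    rw [← sum_indicator_telescope (Finset.univ.filter fun s => M.right s = p)
      (fun s => -M.slope s)
      (fun s hs t ht h => M.eq_of_right_eq_of_slope_eq
        ((Finset.mem_filter.1 hs).2.trans (Finset.mem_filter.1 ht).2.symm) (neg_injective h))]
    refine Finset.sum_congr rfl fun s hs => ?_
    rw [faceBoundary, lowerFace, M.upperFace_eq_of_right (Finset.mem_filter.1 hs).2]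
  have hsum : ∑ s with M.left s = p, (fun Z : M.evenSpace => Z.1 s) =
      ∑ s with M.right s = p, (fun Z : M.evenSpace => Z.1 s) := by
    funext Z
    rw [Finset.sum_apply, Finset.sum_apply]
    exact CharTwo.add_eq_zero.1 (Z.2 p)
  rw [hR, hL, hsum]
  exact CharTwo.add_self_eq_zero _

/-- The boundaries of the regions span the space of even sets: an even set is the sum of the
boundaries of the regions having an odd number of its members above them. -/
lemma eq_sum_faceBoundary [Fintype (M.evenSpace → ZMod 2)] (Z : M.evenSpace) :
    Z.1 = ∑ f : M.evenSpace → ZMod 2, f Z • M.faceBoundary f := by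
  classical
  funext s
  simp only [Finset.sum_apply, Pi.smul_apply, smul_eq_mul, faceBoundary, mul_add, mul_ite, mul_one,
    mul_zero, Finset.sum_add_distrib, Finset.sum_ite_eq, Finset.mem_univ, if_true]
  rw [lowerFace, Pi.add_apply, ← add_assoc, CharTwo.add_self_eq_zero, zero_add]

/-- A segment lies on the boundary of at most two regions. -/
lemma card_faceBoundary_ne_zero_le [Fintype (M.evenSpace → ZMod 2)] (s : S) :
    (Finset.univ.filter fun f => M.faceBoundary f s ≠ 0).card ≤ 2 := by
  classical
  refine (Finset.card_le_card (t := {M.upperFace s, M.lowerFace s}) fun f hf => ?_).trans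
    Finset.card_le_two
  by_contra hcon
  simp only [Finset.mem_insert, Finset.mem_singleton, not_or] at hcon
  refine (Finset.mem_filter.1 hf).2 ?_
  rw [faceBoundary, if_neg (Ne.symm hcon.1), if_neg (Ne.symm hcon.2), add_zero]

end SegmentSystem

/-! ### Cycle spaces with a sparse generating family -/

/-- An acyclic finite graph with an edge has a vertex with a single neighbor. -/
lemma IsAcyclic.exists_leaf {V : Type*} [Finite V] {G : SimpleGraph V} (h : G.IsAcyclic) {a b : V}
    (hab : G.Adj a b) : ∃ u w, ∀ z, G.Adj u z ↔ z = w := by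
  have : Nonempty V := ⟨a⟩
  have : Fintype V := Fintype.ofFinite V
  -- The first vertex of a longest path has no neighbor but the second vertex.
  obtain ⟨u, v, p, hp, hmax⟩ := Walk.exists_isPath_forall_isPath_length_le_length G
  have hnil : ¬ p.Nil := by
    intro hn
    have h1 := hmax a b (.cons hab .nil) (by simp [hab.ne])
    rw [← Walk.length_eq_zero_iff] at hn
    simp [hn] at h1
  refine ⟨u, p.snd, fun z => ⟨fun hz => ?_, fun hz => hz ▸ p.adj_snd hnil⟩⟩
  refine h.eq_snd_of_adj_start hp hz ?_
  by_contra hzp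
  have := hmax _ _ _ (hp.cons (h := hz.symm) hzp)
  simp at this

section CycleSpace

variable {V : Type*} [Fintype V] (G : SimpleGraph V)

open scoped Classical in
/-- A set of edges, given by its indicator function, is even if every vertex is on an even number
of its edges. -/
def IsEvenEdgeSet (z : G.edgeSet → ZMod 2) : Prop :=
  ∀ w, ∑ e : G.edgeSet, (if w ∈ e.1 then z e else 0) = 0

variable {G}

open scoped Classical in
/-- A nonempty even set of edges contains a cycle. -/
lemma IsEvenEdgeSet.le_card {z : G.edgeSet → ZMod 2} (hz : G.IsEvenEdgeSet z) (hne : z ≠ 0)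
    {g : ℕ} (hg : (g : ℕ∞) ≤ G.egirth) : g ≤ (Finset.univ.filter fun e => z e ≠ 0).card := by
  set H : SimpleGraph V := fromEdgeSet {e | ∃ h : e ∈ G.edgeSet, z ⟨e, h⟩ ≠ 0} with hH
  have hHG : H ≤ G := by
    intro a b hab
    rw [hH, fromEdgeSet_adj] at hab
    exact hab.1.1
  have hHadj : ∀ a b (h : G.Adj a b), H.Adj a b ↔ z ⟨s(a, b), h⟩ ≠ 0 := by
    intro a b h
    rw [hH, fromEdgeSet_adj]
    exact ⟨fun h' => h'.1.2, fun h' => ⟨⟨h, h'⟩, h.ne⟩⟩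
  have hcyc : ¬ H.IsAcyclic := by
    intro hac
    obtain ⟨⟨e, he⟩, hze⟩ := Function.ne_iff.1 hne
    induction e using Sym2.ind with
    | _ a b =>
      obtain ⟨u, w, huw⟩ := hac.exists_leaf ((hHadj a b he).2 hze)
      have hw : H.Adj u w := (huw w).2 rfl
      have hsum := hz u
      rw [Finset.sum_eq_single ⟨s(u, w), hHG hw⟩] at hsum
      · rw [if_pos (by simp)] at hsum
        exact (hHadj u w (hHG hw)).1 hw hsum
      · rintro ⟨e, he⟩ - hne'
        split_ifs with hue
        · obtain ⟨y, rfl⟩ := hue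
          by_contra hzy
          have := (huw y).1 ((hHadj u y he).2 hzy)
          subst this
          exact hne' rfl
        · rfl
      · simp
  obtain ⟨a, c, hc⟩ : ∃ (a : V) (c : H.Walk a a), c.IsCycle := by
    simpa [IsAcyclic] using hcyc
  have h1 : (g : ℕ∞) ≤ c.length := (hg.trans (egirth_anti hHG)).trans (egirth_le_length hc)
  have h2 : c.length ≤ H.edgeFinset.card := hc.1.1.length_le_card_edgeFinset
  have h3 : H.edgeFinset.card ≤ (Finset.univ.filter fun e => z e ≠ 0).card := by
    refine (Finset.card_le_card (t := (Finset.univ.filter fun e => z e ≠ 0).image Subtype.val)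
      fun e he => ?_).trans Finset.card_image_le
    rw [mem_edgeFinset] at he
    rw [hH, edgeSet_fromEdgeSet] at he
    obtain ⟨⟨he1, he2⟩, -⟩ := he
    exact Finset.mem_image.2 ⟨⟨e, he1⟩, by simpa using he2, rfl⟩
  exact (by exact_mod_cast h1 : g ≤ c.length).trans (h2.trans h3)

/-- If the even edge sets are spanned by a family of even edge sets containing every edge at most
twice, as is the case for the face boundaries of a plane graph, then the graph is sparse: the
cycle space has dimension at least `|E| - |V| + 1`, and each nonempty member of the family has at
least `g` edges. -/
theorem mul_card_edgeSet_le_of_span {F : Type*} [Fintype F] [Nonempty V] [Fintype G.edgeSet]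
    (D : F → G.edgeSet → ZMod 2) (hD : ∀ f, G.IsEvenEdgeSet (D f))
    (hspan : ∀ z, G.IsEvenEdgeSet z → z ∈ Submodule.span (ZMod 2) (Set.range D))
    (htwo : ∀ e, (Finset.univ.filter fun f => D f e ≠ 0).card ≤ 2) {g : ℕ}
    (hg : (g : ℕ∞) ≤ G.egirth) :
    g * (Fintype.card G.edgeSet + 1) ≤ 2 * Fintype.card G.edgeSet + g * Fintype.card V := by
  classical
  let bd : (G.edgeSet → ZMod 2) →ₗ[ZMod 2] (V → ZMod 2) :=
    { toFun := fun z w => ∑ e : G.edgeSet, if w ∈ e.1 then z e else 0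
      map_add' := fun y z => by
        funext w
        rw [Pi.add_apply, ← Finset.sum_add_distrib]
        exact Finset.sum_congr rfl fun e _ => by split_ifs <;> simp
      map_smul' := fun c z => by
        funext w
        rw [Pi.smul_apply, smul_eq_mul, Finset.mul_sum]
        exact Finset.sum_congr rfl fun e _ => by split_ifs <;> simp }
  have hbd : ∀ z, z ∈ LinearMap.ker bd ↔ G.IsEvenEdgeSet z := by
    intro z
    rw [LinearMap.mem_ker, funext_iff]
    have : ∀ w, bd z w = ∑ e : G.edgeSet, if w ∈ e.1 then z e else 0 := fun _ => rfl
    simp only [this, Pi.zero_apply, IsEvenEdgeSet]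
    exact forall_congr' fun w => by congr!
  -- Every edge has two ends, so the boundary map is not onto.
  have hrange : Module.finrank (ZMod 2) (LinearMap.range bd) < Fintype.card V := by
    rw [← Module.finrank_fintype_fun_eq_card (R := ZMod 2) (η := V)]
    refine Submodule.finrank_lt fun htop => ?_
    obtain ⟨v⟩ := ‹Nonempty V›
    obtain ⟨z, hz⟩ := LinearMap.range_eq_top.1 htop (Pi.single v 1)
    have h1 : ∑ w, bd z w = 1 := by
      rw [hz, Finset.sum_pi_single']; simp
    have h2 : ∑ w, bd z w = 0 := by
      change ∑ w, ∑ e : G.edgeSet, (if w ∈ e.1 then z e else 0) = 0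
      rw [Finset.sum_comm]
      refine Finset.sum_eq_zero fun e _ => ?_
      obtain ⟨e, he⟩ := e
      induction e using Sym2.ind with
      | _ a b =>
        have hab : a ≠ b := G.ne_of_adj he
        rw [← Finset.sum_filter, show (Finset.univ.filter fun w => w ∈ s(a, b)) = {a, b} by
          ext w; simp, Finset.sum_pair hab]
        exact CharTwo.add_self_eq_zero _
    exact one_ne_zero (h1.symm.trans h2)
  have hrank := LinearMap.finrank_range_add_finrank_ker bd
  rw [Module.finrank_fintype_fun_eq_card] at hrank
  set N := Finset.univ.filter fun f => D f ≠ 0 with hN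
  have hker : Module.finrank (ZMod 2) (LinearMap.ker bd) ≤ N.card := by
    have hle : LinearMap.ker bd ≤ Submodule.span (ZMod 2) ((N.image D : Finset _) : Set _) := by
      intro z hz
      refine Submodule.span_le.2 ?_ (hspan z ((hbd z).1 hz))
      rintro _ ⟨f, rfl⟩
      by_cases hf : D f = 0
      · rw [hf]; exact Submodule.zero_mem _
      · exact Submodule.subset_span (by simpa using ⟨f, by simp [hN, hf], rfl⟩)
    refine (Submodule.finrank_mono hle).trans
      ((finrank_span_finset_le_card (R := ZMod 2) (N.image D)).trans Finset.card_image_le)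
  have hcount : N.card * g ≤ 2 * Fintype.card G.edgeSet := by
    have h1 : N.card • g ≤ ∑ f ∈ N, (Finset.univ.filter fun e => D f e ≠ 0).card :=
      Finset.card_nsmul_le_sum _ _ _ fun f hf =>
        ((hD f).le_card (Finset.mem_filter.1 hf).2 hg).trans_eq (by congr!)
    have h2 : ∑ f ∈ N, (Finset.univ.filter fun e => D f e ≠ 0).card =
        ∑ e, (N.filter fun f => D f e ≠ 0).card :=
      Finset.sum_card_bipartiteAbove_eq_sum_card_bipartiteBelow fun f e => D f e ≠ 0
    have h3 : ∑ e, (N.filter fun f => D f e ≠ 0).card ≤ (Finset.univ : Finset G.edgeSet).card • 2 :=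
      Finset.sum_le_card_nsmul _ _ _ fun e _ => (Finset.card_le_card
        (Finset.filter_subset_filter _ (Finset.subset_univ _))).trans (htwo e)
    rw [smul_eq_mul] at h1 h3
    rw [Finset.card_univ] at h3
    linarith
  have h4 : Fintype.card G.edgeSet + 1 ≤ N.card + Fintype.card V := by omega
  calc g * (Fintype.card G.edgeSet + 1) ≤ g * (N.card + Fintype.card V) :=
        Nat.mul_le_mul_left _ h4
    _ ≤ _ := by rw [mul_add, mul_comm g N.card]; omega

end CycleSpace

/-! ### Plane drawings as systems of segments -/

/-- All but finitely many shears give distinct abscissas to the points of a finite set. -/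
lemma exists_shear_injOn (Q : Finset (ℝ × ℝ)) :
    ∃ c : ℝ, ∀ p ∈ Q, ∀ q ∈ Q, p.1 + c * p.2 = q.1 + c * q.2 → p = q := by
  obtain ⟨c, hc⟩ := Infinite.exists_notMem_finset
    ((Q ×ˢ Q).image fun x : (ℝ × ℝ) × (ℝ × ℝ) => (x.2.1 - x.1.1) / (x.1.2 - x.2.2))
  refine ⟨c, fun p hp q hq h => ?_⟩
  by_cases h2 : p.2 = q.2
  · rw [h2, add_left_inj] at h
    exact Prod.ext h h2
  · refine absurd (Finset.mem_image.2 ⟨(p, q), Finset.mk_mem_product hp hq, ?_⟩) hc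
    rw [div_eq_iff (sub_ne_zero.2 h2)]
    linarith

/-- A finite family of nondegenerate plane segments meeting in common endpoints only is, up to a
shear `φ` and the order of endpoints, a `SegmentSystem`. -/
lemma exists_segmentSystem {S : Type*} [Finite S] (a b : S → ℝ × ℝ) (hab : ∀ s, a s ≠ b s)
    (hinter : ∀ s t, s ≠ t → ∀ z ∈ segment ℝ (a s) (b s) ∩ segment ℝ (a t) (b t),
      z = a s ∨ z = b s) :
    ∃ (M : SegmentSystem S) (φ : ℝ × ℝ → ℝ × ℝ), Function.Injective φ ∧
      ∀ s, (M.left s = φ (a s) ∧ M.right s = φ (b s)) ∨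
        (M.left s = φ (b s) ∧ M.right s = φ (a s)) := by
  classical
  have := Fintype.ofFinite S
  obtain ⟨c, hc⟩ := exists_shear_injOn (Finset.univ.image a ∪ Finset.univ.image b)
  have ha : ∀ s, a s ∈ Finset.univ.image a ∪ Finset.univ.image b := fun s => by simp
  have hb : ∀ s, b s ∈ Finset.univ.image a ∪ Finset.univ.image b := fun s => by simp
  let φ : (ℝ × ℝ) →ₗ[ℝ] (ℝ × ℝ) :=
    (LinearMap.fst ℝ ℝ ℝ + c • LinearMap.snd ℝ ℝ ℝ).prod (LinearMap.snd ℝ ℝ ℝ)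
  have hφ : ∀ p, φ p = (p.1 + c * p.2, p.2) := fun p => rfl
  have hφinj : Function.Injective φ := by
    intro p q h
    rw [hφ, hφ, Prod.mk.injEq] at h
    have h2 := h.2
    have h1 := h.1
    rw [h2, add_left_inj] at h1
    exact Prod.ext h1 h2
  have hne : ∀ s, (φ (a s)).1 ≠ (φ (b s)).1 := fun s h => hab s (hc _ (ha s) _ (hb s) h)
  have hseg : ∀ s, segment ℝ (φ (a s)) (φ (b s)) = φ '' segment ℝ (a s) (b s) := fun s =>
    (image_segment ℝ φ.toAffineMap (a s) (b s)).symm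
  set l : S → ℝ × ℝ := fun s => if (φ (a s)).1 < (φ (b s)).1 then φ (a s) else φ (b s) with hl
  set r : S → ℝ × ℝ := fun s => if (φ (a s)).1 < (φ (b s)).1 then φ (b s) else φ (a s) with hr
  have hlr : ∀ s, (l s = φ (a s) ∧ r s = φ (b s)) ∨ (l s = φ (b s) ∧ r s = φ (a s)) := by
    intro s
    by_cases h : (φ (a s)).1 < (φ (b s)).1 <;> simp [hl, hr, h]
  have hends : ∀ s p, (p = l s ∨ p = r s) ↔ (p = φ (a s) ∨ p = φ (b s)) := by
    intro s p
    rcases hlr s with ⟨h1, h2⟩ | ⟨h1, h2⟩ <;> rw [h1, h2]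
    exact or_comm
  have hsegl : ∀ s, segment ℝ (l s) (r s) = φ '' segment ℝ (a s) (b s) := by
    intro s
    rcases hlr s with ⟨h1, h2⟩ | ⟨h1, h2⟩ <;> rw [h1, h2]
    · exact hseg s
    · rw [segment_symm, hseg]
  have hQ : ∀ s p, (p = φ (a s) ∨ p = φ (b s)) →
      ∃ p' ∈ Finset.univ.image a ∪ Finset.univ.image b, φ p' = p := by
    rintro s p (rfl | rfl)
    · exact ⟨_, ha s, rfl⟩
    · exact ⟨_, hb s, rfl⟩
  have hz : ∀ s t, s ≠ t → ∀ z ∈ segment ℝ (l s) (r s) ∩ segment ℝ (l t) (r t),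
      z = l s ∨ z = r s := by
    rintro s t hst z ⟨h1, h2⟩
    rw [hsegl] at h1 h2
    obtain ⟨x, hx, rfl⟩ := h1
    obtain ⟨y, hy, hxy⟩ := h2
    rw [hφinj hxy] at hy
    rw [hends]
    rcases hinter s t hst x ⟨hx, hy⟩ with rfl | rfl
    · exact Or.inl rfl
    · exact Or.inr rfl
  refine ⟨⟨l, r, ?_, ?_, ?_⟩, φ, hφinj, hlr⟩
  · intro s
    by_cases h : (φ (a s)).1 < (φ (b s)).1
    · simp [hl, hr, h]
    · simpa [hl, hr, h] using lt_of_le_of_ne (not_lt.1 h) (hne s).symm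
  · intro s t p hp q hq hpq
    rw [hends] at hp hq
    obtain ⟨p', hp', rfl⟩ := hQ s p hp
    obtain ⟨q', hq', rfl⟩ := hQ t q hq
    rw [hc p' hp' q' hq' hpq]
  · exact hz

/-- Evenness in a `SegmentSystem` obtained by a shear can be tested before the shear. -/
lemma SegmentSystem.isEven_iff {S : Type*} [Fintype S] {M : SegmentSystem S} {a b : S → ℝ × ℝ}
    {φ : ℝ × ℝ → ℝ × ℝ} (hφ : Function.Injective φ)
    (hM : ∀ s, (M.left s = φ (a s) ∧ M.right s = φ (b s)) ∨
        (M.left s = φ (b s) ∧ M.right s = φ (a s))) (Z : S → ZMod 2) :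
    M.IsEven Z ↔ ∀ p, ∑ s, ((if a s = p then Z s else 0) + if b s = p then Z s else 0) = 0 := by
  have hsum : ∀ q, (∑ s with M.left s = q, Z s) + ∑ s with M.right s = q, Z s =
      ∑ s, ((if φ (a s) = q then Z s else 0) + if φ (b s) = q then Z s else 0) := by
    intro q
    rw [Finset.sum_filter, Finset.sum_filter, ← Finset.sum_add_distrib]
    refine Finset.sum_congr rfl fun s _ => ?_
    rcases hM s with ⟨h1, h2⟩ | ⟨h1, h2⟩ <;> rw [h1, h2]
    exact add_comm _ _
  constructor
  · intro h p
    have h1 := hsum (φ p)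
    simp only [hφ.eq_iff] at h1
    exact h1.symm.trans (h (φ p))
  · intro h q
    refine (hsum q).trans ?_
    by_cases hq : ∃ p, φ p = q
    · obtain ⟨p, rfl⟩ := hq
      simp only [hφ.eq_iff]
      exact h p
    · push Not at hq
      simp [hq]

/-- The vertices of a polygonal arc are distinct. -/
lemma polygon_injOn {n : ℕ} {p : ℕ → ℝ × ℝ} (hne : ∀ i < n, p i ≠ p (i + 1))
    (hint : ∀ i j : ℕ, i < j → j < n →
      ∀ z ∈ segment ℝ (p i) (p (i + 1)) ∩ segment ℝ (p j) (p (j + 1)), j = i + 1 ∧ z = p j)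
    {i j : ℕ} (hi : i ≤ n) (hj : j ≤ n) (hij : p i = p j) : i = j := by
  have key : ∀ i j : ℕ, i < j → j ≤ n → p i ≠ p j := by
    intro i j hlt hj heq
    rcases Nat.lt_or_ge (i + 1) j with h1 | h1
    · obtain ⟨m, rfl⟩ : ∃ m, j = m + 1 := ⟨j - 1, by omega⟩
      have h2 := (hint i m (by omega) (by omega) (p (m + 1))
        ⟨heq ▸ left_mem_segment ℝ _ _, right_mem_segment ℝ _ _⟩).2
      exact hne m (by omega) h2.symm
    · obtain rfl : j = i + 1 := by omega
      exact hne i (by omega) heq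
  rcases lt_trichotomy i j with hlt | rfl | hlt
  · exact absurd hij (key i j hlt hj)
  · rfl
  · exact absurd hij.symm (key j i hlt hi)

/-- An end of a polygonal arc is on the segments ending there only. -/
lemma eq_end_of_mem_segment {n : ℕ} {p : ℕ → ℝ × ℝ}
    (hint : ∀ i j : ℕ, i < j → j < n →
      ∀ z ∈ segment ℝ (p i) (p (i + 1)) ∩ segment ℝ (p j) (p (j + 1)), j = i + 1 ∧ z = p j)
    {i : ℕ} (hi : i < n) {z : ℝ × ℝ} (hz : z ∈ segment ℝ (p i) (p (i + 1)))
    (hend : z = p 0 ∨ z = p n) : z = p i ∨ z = p (i + 1) := by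
  rcases hend with rfl | rfl
  · rcases Nat.eq_zero_or_pos i with rfl | h0
    · exact Or.inl rfl
    · exact Or.inl (hint 0 i h0 hi _ ⟨left_mem_segment ℝ _ _, hz⟩).2
  · obtain ⟨m, rfl⟩ : ∃ m, n = m + 1 := ⟨n - 1, by omega⟩
    rcases Nat.lt_or_ge i m with hm | hm
    · obtain ⟨h1, h2⟩ := hint i m hm (by omega) _ ⟨hz, right_mem_segment ℝ _ _⟩
      exact Or.inr (h1 ▸ h2)
    · obtain rfl : i = m := by omega
      exact Or.inr rfl

/-- Along a polygonal arc, each interior vertex is an end of two segments. -/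
lemma sum_arc_indicator {n : ℕ} (p : ℕ → ℝ × ℝ) (q : ℝ × ℝ) (c : ZMod 2) :
    ∑ i : Fin n, ((if p i = q then c else 0) + if p (i + 1) = q then c else 0) =
      (if p 0 = q then c else 0) + if p n = q then c else 0 := by
  rw [Fin.sum_univ_eq_sum_range
    (fun i => (if p i = q then c else 0) + if p (i + 1) = q then c else 0) n]
  induction n with
  | zero => simp [CharTwo.add_self_eq_zero]
  | succ n ih =>
    rw [Finset.sum_range_succ, ih]
    generalize (if p n = q then c else 0) = y
    linear_combination CharTwo.add_self_eq_zero y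

/-- The edges of a plane drawing can be subdivided into the segments of a `SegmentSystem`, in such a
way that the even sets of segments correspond to the even sets of edges. -/
theorem IsPlaneDrawing.exists_subdivision {V : Type*} [Fintype V] {G : SimpleGraph V}
    [Fintype G.edgeSet] {pos : V → ℝ × ℝ} {arc : Sym2 V → Set (ℝ × ℝ)}
    (h : G.IsPlaneDrawing pos arc) :
    ∃ (n : G.edgeSet → ℕ) (first : ∀ e, Fin (n e)) (M : SegmentSystem (Σ e, Fin (n e))),
      (∀ Z, M.IsEven Z → ∀ e i, Z ⟨e, i⟩ = Z ⟨e, first e⟩) ∧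
      ∀ z : G.edgeSet → ZMod 2, M.IsEven (fun s => z s.1) ↔ G.IsEvenEdgeSet z := by
  classical
  have huv : ∀ e : G.edgeSet, ∃ u v, e.1 = s(u, v) := fun e => by
    obtain ⟨e, he⟩ := e
    induction e using Sym2.ind with
    | _ a b => exact ⟨a, b, rfl⟩
  choose u v huv using huv
  have hadj : ∀ e, G.Adj (u e) (v e) := fun e => by
    have := e.2
    rwa [huv e] at this
  have harc : ∀ e : G.edgeSet, IsPolygonalArc (pos (u e)) (pos (v e)) (arc e.1) := fun e => by
    rw [huv e]; exact h.isPolygonalArc _ _ (hadj e)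
  choose n p hn h0 hlast hne hint hA using harc
  have hmem : ∀ e (w : V), w ∈ e.1 ↔ w = u e ∨ w = v e := fun e w => by
    rw [huv e, Sym2.mem_iff]
  have hsub : ∀ e, ∀ i < n e, segment ℝ (p e i) (p e (i + 1)) ⊆ arc e.1 := by
    intro e i hi z hz
    rw [hA e]
    exact Set.mem_biUnion (Set.mem_Iio.2 hi) hz
  have hparc : ∀ e, ∀ i ≤ n e, p e i ∈ arc e.1 := by
    intro e i hi
    rcases Nat.lt_or_ge i (n e) with hlt | hge
    · exact hsub e i hlt (left_mem_segment ℝ _ _)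
    · obtain rfl : i = n e := by omega
      have h1 := hn e
      have h2 := hsub e (n e - 1) (by omega) (right_mem_segment ℝ _ _)
      rwa [Nat.sub_add_cancel h1] at h2
  have hpinj : ∀ e, ∀ i ≤ n e, ∀ j ≤ n e, p e i = p e j → i = j := fun e i hi j hj =>
    polygon_injOn (hne e) (hint e) hi hj
  have hu : ∀ e, ∀ i ≤ n e, p e i = pos (u e) ↔ i = 0 := fun e i hi =>
    ⟨fun hi' => hpinj e i hi 0 (Nat.zero_le _) (hi'.trans (h0 e).symm), fun hi' => hi' ▸ h0 e⟩
  have hv : ∀ e, ∀ i ≤ n e, p e i = pos (v e) ↔ i = n e := fun e i hi =>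
    ⟨fun hi' => hpinj e i hi (n e) le_rfl (hi'.trans (hlast e).symm), fun hi' => hi' ▸ hlast e⟩
  -- Points of different arcs coincide in common ends only.
  have hpp : ∀ e f, e ≠ f → ∀ i ≤ n e, ∀ j ≤ n f, p e i = p f j → i = 0 ∨ i = n e := by
    intro e f hef i hi j hj hij
    obtain ⟨w, hwe, -, hw⟩ := h.inter_arc e.1 e.2 f.1 f.2 (fun h' => hef (Subtype.ext h'))
      (p e i) ⟨hparc e i hi, hij ▸ hparc f j hj⟩
    rcases (hmem e w).1 hwe with rfl | rfl
    · exact Or.inl ((hu e i hi).1 hw)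
    · exact Or.inr ((hv e i hi).1 hw)
  have hn0 : ∀ e, 0 < n e := hn
  set a : (Σ e : G.edgeSet, Fin (n e)) → ℝ × ℝ := fun s => p s.1 s.2 with ha
  set b : (Σ e : G.edgeSet, Fin (n e)) → ℝ × ℝ := fun s => p s.1 (s.2 + 1) with hb
  obtain ⟨M, φ, hφ, hM⟩ := exists_segmentSystem a b (fun s => hne s.1 s.2 s.2.2) (by
    rintro ⟨e, i, hi⟩ ⟨f, j, hj⟩ hst z ⟨hz1, hz2⟩
    simp only [ha, hb] at hz1 hz2 ⊢
    by_cases hef : e = f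
    · subst hef
      rcases lt_trichotomy i j with hij | rfl | hij
      · obtain ⟨h1, h2⟩ := hint e i j hij hj z ⟨hz1, hz2⟩
        exact Or.inr (h1 ▸ h2)
      · exact absurd rfl hst
      · exact Or.inl (hint e j i hij hi z ⟨hz2, hz1⟩).2
    · obtain ⟨w, hwe, -, hw⟩ := h.inter_arc e.1 e.2 f.1 f.2 (fun h' => hef (Subtype.ext h')) z
        ⟨hsub e i hi hz1, hsub f j hj hz2⟩
      refine eq_end_of_mem_segment (hint e) hi hz1 ?_
      rcases (hmem e w).1 hwe with rfl | rfl
      · exact Or.inl (hw.trans (h0 e).symm)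
      · exact Or.inr (hw.trans (hlast e).symm))
  have heven := fun Z => SegmentSystem.isEven_iff hφ hM Z
  -- An even set of segments contains all segments of an arc or none.
  have hconst : ∀ Z, M.IsEven Z → ∀ e (i : Fin (n e)), Z ⟨e, i⟩ = Z ⟨e, ⟨0, hn0 e⟩⟩ := by
    rintro Z hZ e ⟨i, hi⟩
    induction i with
    | zero => rfl
    | succ i ih =>
      rw [← ih (by omega)]
      have h1 := (heven Z).1 hZ (p e (i + 1))
      have hkey : ∀ f j, j ≤ n f → p f j = p e (i + 1) → f = e ∧ j = i + 1 := by
        intro f j hj hfe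
        have hfe' : f = e := by
          by_contra hne'
          rcases hpp e f (Ne.symm hne') (i + 1) (by omega) j hj hfe.symm with h2 | h2 <;> omega
        subst hfe'
        exact ⟨rfl, hpinj f j hj (i + 1) (by omega) hfe⟩
      rw [Finset.sum_add_distrib, Finset.sum_eq_single ⟨e, ⟨i + 1, hi⟩⟩,
        Finset.sum_eq_single ⟨e, ⟨i, by omega⟩⟩, if_pos rfl, if_pos rfl] at h1
      · exact CharTwo.add_eq_zero.1 h1
      · rintro ⟨f, j, hj⟩ - hne'
        refine if_neg fun hfe => hne' ?_
        obtain ⟨rfl, h3⟩ := hkey f (j + 1) hj hfe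
        obtain rfl : j = i := by omega
        rfl
      · simp
      · rintro ⟨f, j, hj⟩ - hne'
        refine if_neg fun hfe => hne' ?_
        obtain ⟨rfl, rfl⟩ := hkey f j hj.le hfe
        rfl
      · simp
  -- A set of edges is even if and only if the set of segments of their arcs is even.
  have hlift : ∀ z : G.edgeSet → ZMod 2, M.IsEven (fun s => z s.1) ↔ G.IsEvenEdgeSet z := by
    intro z
    have hsum : ∀ q, ∑ s : (Σ e : G.edgeSet, Fin (n e)),
        ((if a s = q then z s.1 else 0) + if b s = q then z s.1 else 0) =
        ∑ e, ((if pos (u e) = q then z e else 0) + if pos (v e) = q then z e else 0) := by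
      intro q
      rw [Fintype.sum_sigma]
      refine Finset.sum_congr rfl fun e _ => ?_
      rw [← h0 e, ← hlast e]
      exact sum_arc_indicator (p e) q (z e)
    have hpos : ∀ w, ∑ e, ((if pos (u e) = pos w then z e else 0) +
        if pos (v e) = pos w then z e else 0) = ∑ e : G.edgeSet, if w ∈ e.1 then z e else 0 := by
      intro w
      refine Finset.sum_congr rfl fun e _ => ?_
      simp only [h.pos_injective.eq_iff, hmem]
      by_cases h1 : u e = w
      · have h2 : v e ≠ w := fun h2 => (hadj e).ne (h1.trans h2.symm)
        simp [h1, h2]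
      · by_cases h2 : v e = w <;> simp [h1, h2, Ne.symm h1]
        exact fun h3 => absurd h3.symm h2
    rw [heven]
    constructor
    · intro hz w
      have := hz (pos w)
      rw [hsum, hpos] at this
      convert this
    · intro hz q
      rw [hsum]
      by_cases hq : ∃ w, pos w = q
      · obtain ⟨w, rfl⟩ := hq
        rw [hpos]
        convert hz w
      · push Not at hq
        simp [hq]
  exact ⟨n, fun e => ⟨0, hn0 e⟩, M, hconst, hlift⟩

/-- A plane graph of girth at least `g` is sparse. -/
theorem IsPlaneDrawing.mul_card_edgeSet_le {V : Type*} [Fintype V] [Nonempty V]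
    {G : SimpleGraph V} [Fintype G.edgeSet] {pos : V → ℝ × ℝ} {arc : Sym2 V → Set (ℝ × ℝ)}
    (h : G.IsPlaneDrawing pos arc) {g : ℕ} (hg : (g : ℕ∞) ≤ G.egirth) :
    g * (Fintype.card G.edgeSet + 1) ≤ 2 * Fintype.card G.edgeSet + g * Fintype.card V := by
  classical
  obtain ⟨n, first, M, hconst, hlift⟩ := h.exists_subdivision
  have : Fintype (M.evenSpace → ZMod 2) := Fintype.ofFinite _
  have hface : ∀ f, (fun s : Σ e, Fin (n e) => M.faceBoundary f ⟨s.1, first s.1⟩) =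
      M.faceBoundary f := fun f =>
    funext fun s => (hconst _ (M.isEven_faceBoundary f) s.1 s.2).symm
  refine mul_card_edgeSet_le_of_span (fun f e => M.faceBoundary f ⟨e, first e⟩) (fun f => ?_)
    (fun z hz => ?_) (fun e => M.card_faceBoundary_ne_zero_le _) hg
  · rw [← hlift, hface]
    exact M.isEven_faceBoundary f
  · have hsum := M.eq_sum_faceBoundary ⟨_, (hlift z).2 hz⟩
    have hz' : z = ∑ f : M.evenSpace → ZMod 2, f ⟨_, (hlift z).2 hz⟩ •
        fun e => M.faceBoundary f ⟨e, first e⟩ := by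
      funext e
      have := congrFun hsum ⟨e, first e⟩
      simpa [Finset.sum_apply] using this
    rw [hz']
    exact Submodule.sum_mem _ fun f _ => Submodule.smul_mem _ _ (Submodule.subset_span ⟨f, rfl⟩)

/-! ### Planar graphs of large girth -/

lemma IsPlaneDrawing.coe {V : Type*} {G : SimpleGraph V} {pos : V → ℝ × ℝ}
    {arc : Sym2 V → Set (ℝ × ℝ)} (h : G.IsPlaneDrawing pos arc) (H : G.Subgraph) :
    H.coe.IsPlaneDrawing (fun v => pos v.1) (fun e => arc (e.map Subtype.val)) := by
  have hedge : ∀ e ∈ H.coe.edgeSet, e.map Subtype.val ∈ G.edgeSet := by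
    intro e he
    induction e using Sym2.ind with
    | _ x y => exact H.adj_sub he
  refine ⟨fun u v huv => Subtype.ext (h.pos_injective huv),
    fun u v huv => h.isPolygonalArc u.1 v.1 (H.adj_sub huv), fun e he w hw => ?_,
    fun e he f hf hef z hz => ?_⟩
  · obtain ⟨x, hx, hxw⟩ := Sym2.mem_map.1 (h.mem_of_pos_mem _ (hedge e he) w.1 hw)
    rwa [Subtype.ext hxw] at hx
  · obtain ⟨w, hwe, hwf, hw⟩ := h.inter_arc _ (hedge e he) _ (hedge f hf)
      (fun heq => hef (Sym2.map.injective Subtype.val_injective heq)) z hz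
    obtain ⟨x, hx, rfl⟩ := Sym2.mem_map.1 hwe
    obtain ⟨y, hy, hyx⟩ := Sym2.mem_map.1 hwf
    exact ⟨x, hx, Subtype.ext hyx ▸ hy, hw⟩

/-- A planar graph of girth at least `g` has maximum average degree less than `2 * g / (g - 2)`;
the bound is stated for a number `r ≥ 4 / (g - 2)`. -/
theorem IsPlanar.mad_lt {V : Type*} [Finite V] [Nonempty V] {G : SimpleGraph V} (h : G.IsPlanar)
    {g : ℕ} (hg : (g : ℕ∞) ≤ G.egirth) (hg2 : 2 < g) {r : ℝ} (hr : 4 ≤ r * ((g : ℝ) - 2)) :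
    G.mad < 2 + r := by
  classical
  obtain ⟨pos, arc, h⟩ := h
  have : Nonempty {H : G.Subgraph // H.verts.Nonempty} := ⟨⟨⊤, Set.univ_nonempty⟩⟩
  obtain ⟨⟨H, hH⟩, hmax⟩ := exists_eq_ciSup_of_finite
    (f := fun H : {H : G.Subgraph // H.verts.Nonempty} =>
      2 * (H.1.edgeSet.ncard : ℝ) / (H.1.verts.ncard : ℝ))
  rw [mad, ← hmax]
  have : Fintype H.verts := Fintype.ofFinite _
  have : Fintype H.coe.edgeSet := Fintype.ofFinite _
  have : Nonempty H.verts := hH.to_subtype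
  have hgH : (g : ℕ∞) ≤ H.coe.egirth := hg.trans (IsContained.egirth_le H.coe_isContained)
  have hcount := (h.coe H).mul_card_edgeSet_le hgH
  have hE : H.edgeSet.ncard = Fintype.card H.coe.edgeSet := by
    rw [← Subgraph.image_coe_edgeSet_coe, Set.ncard_image_of_injective _
      (Sym2.map.injective Subtype.val_injective), ← Nat.card_coe_set_eq, Nat.card_eq_fintype_card]
  have hN : H.verts.ncard = Fintype.card H.verts := by
    rw [← Nat.card_coe_set_eq, Nat.card_eq_fintype_card]
  have hpos : (0 : ℝ) < H.verts.ncard := by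
    rw [hN]; exact_mod_cast Fintype.card_pos
  rw [← hE, ← hN] at hcount
  have hcount' : (g : ℝ) * (H.edgeSet.ncard + 1) ≤
      2 * H.edgeSet.ncard + g * H.verts.ncard := by exact_mod_cast hcount
  have hg2' : (2 : ℝ) < g := by exact_mod_cast hg2
  rw [div_lt_iff₀ hpos]
  refine lt_of_mul_lt_mul_right ?_ (by linarith : (0 : ℝ) ≤ (g : ℝ) - 2)
  have := mul_le_mul_of_nonneg_left hr hpos.le
  nlinarith

end SimpleGraph

theorem mainTheorem1 {V : Type*} [Fintype V] (G : SimpleGraph V) [DecidableRel G.Adj] :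
    (∀ k : ℕ, 6 ≤ k → G.maxDegree ≤ k →
      G.mad < 2 + (4 * (k : ℝ) - 8) / (5 * (k : ℝ) + 2) →
      G.square.choiceNumber ≤ (k : ℕ∞) + 1) ∧
    (6 ≤ G.maxDegree →
      G.mad < 2 + (4 * (G.maxDegree : ℝ) - 8) / (5 * (G.maxDegree : ℝ) + 2) →
      G.square.choiceNumber = (G.maxDegree : ℕ∞) + 1) ∧
    (6 ≤ G.maxDegree → G.IsPlanar →
      ∀ g : ℕ, 7 + 12 / ((G.maxDegree : ℝ) - 2) ≤ (g : ℝ) → (g : ℕ∞) ≤ G.egirth →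
      G.square.choiceNumber = (G.maxDegree : ℕ∞) + 1) := by
  refine ⟨fun k hk hdeg hmad => ?_, fun hdeg hmad => G.choiceNumber_square_eq_of_mad_lt hdeg hmad,
    fun hdeg hplanar g hg hgirth => G.choiceNumber_square_eq_of_mad_lt hdeg ?_⟩
  · exact_mod_cast SimpleGraph.choiceNumber_le (G.isChoosable_square_of_mad_lt hk hdeg hmad)
  · have : Nonempty V := by
      by_contra hV
      rw [not_nonempty_iff] at hV
      have := G.maxDegree_of_subsingleton
      omega
    have hΔ : (6 : ℝ) ≤ G.maxDegree := by exact_mod_cast hdeg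
    have hD : (0 : ℝ) < (G.maxDegree : ℝ) - 2 := by linarith
    have h12 : 0 < 12 / ((G.maxDegree : ℝ) - 2) := by positivity
    have hg2 : 2 < g := by
      have : (2 : ℝ) < g := by linarith
      exact_mod_cast this
    refine hplanar.mad_lt hgirth hg2 ?_
    have h1 : (5 * (G.maxDegree : ℝ) + 2) / (G.maxDegree - 2) ≤ (g : ℝ) - 2 := by
      have : (5 * (G.maxDegree : ℝ) + 2) / (G.maxDegree - 2) =
          5 + 12 / ((G.maxDegree : ℝ) - 2) := by
        field_simp
        ring
      linarith
    rw [div_mul_eq_mul_div, le_div_iff₀ (by linarith)]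
    rw [div_le_iff₀ hD] at h1
    linarith
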